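/- **Stronger PRUs.** For each $n\ge 1$ let $K_n$ be a finite nonempty set of keys, written as bit strings, and let $\{U_{n,k}\}_{k\in K_n}$ be $n$-qubit unitaries. Let $\mathcal O$ be a set of query types. The family $\mathcal U=\{U_{n,k}\}$ is a *pseudorandom unitary (PRU) secure against $\mathcal O$ queries* if * (efficient generation) there is a quantum algorithm which, on input $n\ge 1$ and $k\in K_n$, computes the matrix $U_{n,k}$ in time $\mathrm{poly}(n)$; that is, on the further input $m$ it applies, in time $\mathrm{poly}(n+m)$, a circuit that maps $|\psi\rangle|0\rangle$ to $(U_{n,k}|\psi\rangle)|0\rangle$ up to error $2^{-m}$ in operator norm (where $|0\rangle$ is the state of the ancilla qubits); * (indistinguishability from Haar) for every $\mathrm{poly}(n)$-time oracle circuit $A$ all of whose queries are of types in $\mathcal O$, $$\Big|\Pr_{k\sim K_n}[A(U_{n,k})\text{ accepts}]-\Pr_{U\sim \mathrm{Haar}_n}[A(U)\text{ accepts}]\Big|$$ is negligible in $n$, where $k$ is uniform in $K_n$ and $\mathrm{Haar}_n$ is the Haar probability measure on $n$-qubit unitaries. Here a $\mathrm{poly}(n)$-time algorithm is a classical multi-stack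 program with a step count that applies, one after the other, Hadamard gates, NOT, CNOT and Toffoli gates, phase gates $\mathrm{diag}(1,e^{2\pi i/2^j})$ and, for oracle circuits, queries; oracle circuits are either uniform or have an advice string depending only on $n$, and start with all qubits in state $|0\rangle$. Let $S\subseteq\{U,U^\dagger,U^*,U^{\mathsf T}\}$ be any subset, and let $\mathcal U$ be a PRU secure against queries in $S$. Let $q_n=2^n$, let $C_{q_n}=\{e^{2\pi i x/q_n}\mid 0\le x<q_n\}$ and $K_n^+=K_n\times C_{q_n}$, and define $U_{n,(k,\varphi)}=\varphi\cdot U_{n,k}$ for $(k,\varphi)\in K_n^+$. Then $\mathcal U^+=\{U_{n,(k,\varphi)}\}$ is a PRU secure against the corresponding subset of $\{\mathrm{c}U,\mathrm{c}U^\dagger,\mathrm{c}U^*,\mathrm{c}U^{\mathsf T}\}$ queries, where $\mathrm{c}V=|0\rangle\langle 0|\otimes I+|1\rangle\langle 1|\otimes V$. This holds for uniform adversaries (in hypothesis and conclusion), and likewise for adversaries with advice. -/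

import Mathlib

noncomputable section

namespace PRU

open Filter MeasureTheory

/-! ## Queries, gates and circuits -/

/-- The four forms `U`, `U†`, `U*`, `Uᵀ` in which a unitary can be accessed. -/
inductive QueryOp
  | plain
  | adjoint
  | conj
  | transpose

/-- A query type: one of the four forms, either uncontrolled or with a control qubit. -/
inductive Query
  | uncontrolled (o : QueryOp)
  | controlled (o : QueryOp)

/-- Qubits are arranged in countably many arrays; the qubit `(a, i)` is the one at position `i` of
array number `a`. The general form `Gate ι` also serves for the gate-emitting instructions of a
program, where positions are given by registers of the program.

* `not`, `cnot`, `toffoli` are the classical reversible gates (the last argument is the target);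
* `hadamard` is the Hadamard gate;
* `phase j` is the one-qubit gate `diag(1, exp(2πi / 2^j))`;
* `query q` is a call to the oracle. Its target is formed by the qubits `(0, 0), …, (0, n-1)`, and
  its control qubit, if it has one, is `(1, 0)`. -/
inductive Gate (ι : Type)
  | not (a : ℕ × ι)
  | cnot (a b : ℕ × ι)
  | toffoli (a b c : ℕ × ι)
  | hadamard (a : ℕ × ι)
  | phase (j : ι) (a : ℕ × ι)
  | query (q : Query)

/-- The name of a qubit: array number and position. -/
abbrev Wire := ℕ × ℕ

/-- A circuit is the list of its gates, in the order in which they are applied. -/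
abbrev Circuit := List (Gate ℕ)

namespace Gate

/-- Substitution of the positions in a gate. -/
def map {ι κ : Type} (f : ι → κ) : Gate ι → Gate κ
  | not a => not (a.1, f a.2)
  | cnot a b => cnot (a.1, f a.2) (b.1, f b.2)
  | toffoli a b c => toffoli (a.1, f a.2) (b.1, f b.2) (c.1, f c.2)
  | hadamard a => hadamard (a.1, f a.2)
  | phase j a => phase (f j) (a.1, f a.2)
  | query q => query q

/-- The cost of writing down a gate, with positions in unary. -/
def cost : Gate ℕ → ℕ
  | not a => a.2 + 1
  | cnot a b => a.2 + b.2 + 1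
  | toffoli a b c => a.2 + b.2 + c.2 + 1
  | hadamard a => a.2 + 1
  | phase j a => j + a.2 + 1
  | query _ => 1

/-- The gate is an ordinary gate or a query of a type in `Q`. -/
def Allowed (Q : Set Query) {ι : Type} : Gate ι → Prop
  | query q => q ∈ Q
  | _ => True

end Gate

/-- All queries of the circuit are of types in `Q`. -/
def Circuit.Allowed (Q : Set Query) (c : Circuit) : Prop := ∀ g ∈ c, g.Allowed Q

/-! ## Quantum semantics of circuits -/

/-- Pure states. A computational basis state is named by the finite set of the qubits that are `1`
in it (all others are `0`), and a state is a finite linear combination of basis states. -/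
abbrev State := Finset Wire →₀ ℂ

/-- The computational basis state in which exactly the qubits in `s` are `1`. -/
def ket (s : Finset Wire) : State := Finsupp.single s 1

/-- The squared `ℓ²` norm. -/
def normSq (ψ : State) : ℝ := ψ.sum fun _ z => ‖z‖ ^ 2

/-- The `ℓ²` norm. -/
def l2norm (ψ : State) : ℝ := Real.sqrt (normSq ψ)

/-- The linear map with prescribed values on basis states. -/
def extend (f : Finset Wire → State) : State →ₗ[ℂ] State := Finsupp.linearCombination ℂ f

/-- Flip the qubit `w`. -/
def flip (w : Wire) (s : Finset Wire) : Finset Wire := symmDiff s {w}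

/-- The content of the target qubits `(0, 0), …, (0, n-1)` of the oracle. -/
def readTarget (n : ℕ) (s : Finset Wire) : Fin n → Bool := fun i => decide ((0, (i : ℕ)) ∈ s)

/-- Overwrite the target qubits `(0, 0), …, (0, n-1)` of the oracle by `y`. -/
def writeTarget (n : ℕ) (y : Fin n → Bool) (s : Finset Wire) : Finset Wire :=
  (s.filter fun w => ¬ (w.1 = 0 ∧ w.2 < n)) ∪
    (Finset.univ.filter fun i => y i = true).image fun i : Fin n => (0, (i : ℕ))

/-- `2^n × 2^n` matrices, rows and columns indexed by `n`-bit strings. -/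
abbrev QMatrix (n : ℕ) := Matrix (Fin n → Bool) (Fin n → Bool) ℂ

/-- The group of `n`-qubit unitaries. -/
abbrev QUnitary (n : ℕ) := Matrix.unitaryGroup (Fin n → Bool) ℂ

/-- `V`, `V†`, `V*` or `Vᵀ`. -/
def QueryOp.apply {n : ℕ} (V : QMatrix n) : QueryOp → QMatrix n
  | plain => V
  | adjoint => V.conjTranspose
  | conj => V.map star
  | transpose => V.transpose

/-- The action of an `n`-qubit matrix on the target qubits of the oracle, on basis states. -/
def applyTarget {n : ℕ} (V : QMatrix n) (s : Finset Wire) : State :=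
  ∑ y : Fin n → Bool, V y (readTarget n s) • ket (writeTarget n y s)

/-- The action of a gate on basis states, when the oracle is the `n`-qubit matrix `V`. A gate on
several qubits acts as the identity unless these are distinct. -/
def Gate.onBasis {n : ℕ} (V : QMatrix n) : Gate ℕ → Finset Wire → State
  | .not a, s => ket (flip a s)
  | .cnot a b, s => if a ≠ b ∧ a ∈ s then ket (flip b s) else ket s
  | .toffoli a b c, s =>
      if (a ≠ b ∧ a ≠ c ∧ b ≠ c) ∧ a ∈ s ∧ b ∈ s then ket (flip c s) else ket s
  | .hadamard a, s =>
      ((1 / Real.sqrt 2 : ℝ) : ℂ) •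
        (ket (s.erase a) + (if a ∈ s then (-1 : ℂ) else 1) • ket (insert a s))
  | .phase j a, s =>
      if a ∈ s then Complex.exp (2 * Real.pi * Complex.I / 2 ^ j) • ket s else ket s
  | .query (.uncontrolled o), s => applyTarget (o.apply V) s
  | .query (.controlled o), s =>
      if ((1, 0) : Wire) ∈ s then applyTarget (o.apply V) s else ket s

/-- Run a circuit with oracle `V` on a state. -/
def runCircuit {n : ℕ} (V : QMatrix n) (c : Circuit) (ψ : State) : State :=
  c.foldl (fun ψ g => extend (g.onBasis V) ψ) ψ

/-- The probability that a circuit with oracle `V`, started with all qubits in state `0`, accepts: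
the final measurement of the output qubit `(2, 0)` gives `1`. -/
def acceptProb {n : ℕ} (V : QMatrix n) (c : Circuit) : ℝ :=
  normSq ((runCircuit V c (ket ∅)).filter fun s => ((2, 0) : Wire) ∈ s)

/-- The `n`-qubit vector `ψ` on the qubits `(0, 0), …, (0, n-1)`, all other qubits being `0`. -/
def embed {n : ℕ} (ψ : (Fin n → Bool) → ℂ) : State :=
  ∑ x : Fin n → Bool, ψ x • ket (writeTarget n x ∅)

/-- The circuit computes the matrix `W` up to error `ε` in operator norm: it takes `|ψ⟩|0⟩`
to `(W|ψ⟩)|0⟩`, the second factor being the ancilla qubits. -/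
def Computes {n : ℕ} (c : Circuit) (W : QMatrix n) (ε : ℝ) : Prop :=
  ∀ ψ : (Fin n → Bool) → ℂ,
    l2norm (runCircuit (1 : QMatrix n) c (embed ψ) - embed (W.mulVec ψ)) ≤ ε * l2norm (embed ψ)

/-! ## Algorithms

A quantum algorithm is a classical program with an explicit step count, which applies quantum gates
one after the other. The classical machine is a multi-stack machine in structured form: it has
finitely many registers (those mentioned in the program), each holding a stack of bits. -/

/-- Programs. `branch r p q t` runs `p` if register `r` is empty, `q` if its top bit is `0` and `t`
if its top bit is `1`. `loop r p` repeats `p` as long as register `r` is not empty. `emit g` applies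
the gate `g`, in which positions (and the `j` of a phase gate) are given by the heights of the named
registers. -/
inductive Prog
  | skip
  | push (r : ℕ) (b : Bool)
  | pop (r : ℕ)
  | emit (g : Gate ℕ)
  | seq (p q : Prog)
  | branch (r : ℕ) (p q t : Prog)
  | loop (r : ℕ) (p : Prog)

/-- The content of the registers, top of the stack first. -/
abbrev Store := ℕ → List Bool

/-- `Exec P s c t s'`: started on the store `s`, the program `P` halts after `t` steps with the
store `s'`, having applied the gates of the circuit `c`. -/
inductive Exec : Prog → Store → Circuit → ℕ → Store → Prop
  | skip (s : Store) : Exec .skip s [] 1 s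
  | push (r : ℕ) (b : Bool) (s : Store) :
      Exec (.push r b) s [] 1 (Function.update s r (b :: s r))
  | pop (r : ℕ) (s : Store) :
      Exec (.pop r) s [] 1 (Function.update s r (s r).tail)
  | emit (g : Gate ℕ) (s : Store) :
      Exec (.emit g) s [g.map fun r => (s r).length] (g.map fun r => (s r).length).cost s
  | seq {p q : Prog} {s s₁ s₂ : Store} {c₁ c₂ : Circuit} {t₁ t₂ : ℕ} :
      Exec p s c₁ t₁ s₁ → Exec q s₁ c₂ t₂ s₂ → Exec (.seq p q) s (c₁ ++ c₂) (t₁ + t₂) s₂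
  | branchEmpty {r : ℕ} {p q u : Prog} {s s₁ : Store} {c : Circuit} {t : ℕ} :
      s r = [] → Exec p s c t s₁ → Exec (.branch r p q u) s c (t + 1) s₁
  | branchFalse {r : ℕ} {p q u : Prog} {s s₁ : Store} {c : Circuit} {t : ℕ} :
      (s r).head? = some false → Exec q s c t s₁ → Exec (.branch r p q u) s c (t + 1) s₁
  | branchTrue {r : ℕ} {p q u : Prog} {s s₁ : Store} {c : Circuit} {t : ℕ} :
      (s r).head? = some true → Exec u s c t s₁ → Exec (.branch r p q u) s c (t + 1) s₁
  | loopDone {r : ℕ} {p : Prog} {s : Store} :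
      s r = [] → Exec (.loop r p) s [] 1 s
  | loopStep {r : ℕ} {p : Prog} {s s₁ s₂ : Store} {c₁ c₂ : Circuit} {t₁ t₂ : ℕ} :
      s r ≠ [] → Exec p s c₁ t₁ s₁ → Exec (.loop r p) s₁ c₂ t₂ s₂ →
        Exec (.loop r p) s (c₁ ++ c₂) (t₁ + t₂ + 1) s₂

/-- The initial store: `n` in unary in register `0`, a bit string (a key or an advice string) in
register `1`, a second number `m` in unary in register `2`; the other registers are empty. -/
def inputStore (n : ℕ) (w : List Bool) (m : ℕ) : Store
  | 0 => List.replicate n true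
  | 1 => w
  | 2 => List.replicate m true
  | _ => []

/-! ## Pseudorandom unitaries -/

/-- A family `{U_{n,k}}` of `n`-qubit unitaries `U_{n,k}`, for `k` in a finite set of keys `K_n`.
Keys are written as bit strings. (The entries for `n = 0` play no role.) -/
structure UnitaryFamily where
  Key : ℕ → Type
  fintypeKey : ∀ n, Fintype (Key n)
  nonemptyKey : ∀ n, Nonempty (Key n)
  encode : ∀ n, Key n → List Bool
  encode_injective : ∀ n, Function.Injective (encode n)
  unitary : ∀ n, Key n → QUnitary n

attribute [instance] UnitaryFamily.fintypeKey UnitaryFamily.nonemptyKey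

/-- Efficient generation: there is an algorithm which, on input `n ≥ 1`, a key `k ∈ K_n` and an
accuracy parameter `m`, computes `U_{n,k}` up to error `2^{-m}`, in time polynomial in `n` and `m`
(the accuracy parameter makes the notion independent of the choice of a universal gate set). -/
def UnitaryFamily.EfficientlyGenerated (𝒰 : UnitaryFamily) : Prop :=
  ∃ (P : Prog) (p : Polynomial ℕ), ∀ n : ℕ, 1 ≤ n → ∀ (k : 𝒰.Key n) (m : ℕ),
    ∃ (c : Circuit) (t : ℕ) (s : Store),
      Exec P (inputStore n (𝒰.encode n k) m) c t s ∧ t ≤ p.eval (n + m) ∧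
        c.Allowed ∅ ∧ Computes c (𝒰.unitary n k : QMatrix n) ((1 / 2 : ℝ) ^ m)

/-- Whether adversaries are uniform, or get an advice string that depends on `n` only. -/
inductive Uniformity
  | uniform
  | nonuniform

/-- The advice strings an adversary may have. -/
def Uniformity.Admits : Uniformity → (ℕ → List Bool) → Prop
  | uniform, a => ∀ n, a n = []
  | nonuniform, _ => True

/-- `c` is a polynomial-time oracle circuit (family) with queries of types in `Q`: the circuit `c n`
is produced and run by one fixed program in time polynomial in `n`. -/
def IsEfficientOracleCircuit (Q : Set Query) (u : Uniformity) (c : ℕ → Circuit) : Prop :=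
  ∃ (P : Prog) (p : Polynomial ℕ) (a : ℕ → List Bool), u.Admits a ∧ ∀ n : ℕ, 1 ≤ n →
    (c n).Allowed Q ∧ ∃ (t : ℕ) (s : Store), Exec P (inputStore n (a n) 0) (c n) t s ∧ t ≤ p.eval n

instance (n : ℕ) : CompactSpace (QUnitary n) := by
  refine isCompact_iff_compactSpace.mp ?_
  have hK : IsCompact (Set.univ.pi fun _ : Fin n → Bool =>
      Set.univ.pi fun _ : Fin n → Bool => Metric.closedBall (0 : ℂ) 1) :=
    isCompact_univ_pi fun _ => isCompact_univ_pi fun _ => isCompact_closedBall _ _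
  refine hK.of_isClosed_subset (isClosed_unitary (R := QMatrix n)) fun V hV => ?_
  simp only [Set.mem_pi, Set.mem_univ, forall_true_left, mem_closedBall_zero_iff]
  exact fun i j => entry_norm_bound_of_unitary hV i j

instance (n : ℕ) : MeasurableSpace (QUnitary n) := borel _

instance (n : ℕ) : BorelSpace (QUnitary n) := ⟨rfl⟩

/-- The Haar probability measure on `n`-qubit unitaries. -/
def haar (n : ℕ) : Measure (QUnitary n) := Measure.haarMeasure ⊤

/-- The probability that `c` accepts on `U_{n,k}` for a uniformly random key `k ∈ K_n`. -/
def UnitaryFamily.keyAcceptProb (𝒰 : UnitaryFamily) (n : ℕ) (c : Circuit) : ℝ :=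
  (∑ k : 𝒰.Key n, acceptProb (𝒰.unitary n k : QMatrix n) c) / Fintype.card (𝒰.Key n)

/-- The probability that `c` accepts on a Haar-random `n`-qubit unitary. -/
def haarAcceptProb (n : ℕ) (c : Circuit) : ℝ :=
  ∫ V : QUnitary n, acceptProb (V : QMatrix n) c ∂(haar n)

/-- A negligible function: it decays faster than every inverse polynomial. -/
def Negligible (f : ℕ → ℝ) : Prop :=
  Asymptotics.SuperpolynomialDecay atTop (fun n : ℕ => (n : ℝ)) f

/-- Indistinguishability from Haar for efficient adversaries with queries of types in `Q`. -/
def UnitaryFamily.IndistinguishableFromHaar (𝒰 : UnitaryFamily) (Q : Set Query) (u : Uniformity) :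
    Prop :=
  ∀ c : ℕ → Circuit, IsEfficientOracleCircuit Q u c →
    Negligible fun n => |𝒰.keyAcceptProb n (c n) - haarAcceptProb n (c n)|

/-- `𝒰` is a pseudorandom unitary, secure against queries of types in `Q`. -/
def UnitaryFamily.IsPRU (𝒰 : UnitaryFamily) (Q : Set Query) (u : Uniformity) : Prop :=
  𝒰.EfficientlyGenerated ∧ 𝒰.IndistinguishableFromHaar Q u

/-! ## Multiplication by a random phase -/

/-- The phase `exp(2πi x / 2^n)`. These are the `2^n`-th roots of unity. -/
def rootPhase (n : ℕ) (x : Fin (2 ^ n)) : ℂ :=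
  Complex.exp (2 * Real.pi * Complex.I * ((x : ℕ) : ℂ) / 2 ^ n)

theorem rootPhase_mul_star (n : ℕ) (x : Fin (2 ^ n)) : rootPhase n x * star (rootPhase n x) = 1 := by
  have h : rootPhase n x = Complex.exp (((2 * Real.pi * ((x : ℕ) : ℝ) / 2 ^ n : ℝ) : ℂ) * Complex.I) := by
    unfold rootPhase
    congr 1
    push_cast
    ring
  have h1 : ‖rootPhase n x‖ = 1 := by rw [h, Complex.norm_exp_ofReal_mul_I]
  have h2 : rootPhase n x * star (rootPhase n x) = ((‖rootPhase n x‖ ^ 2 : ℝ) : ℂ) := by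
    push_cast
    exact Complex.mul_conj' _
  rw [h2, h1]
  simp

/-- The unitary `φ · V`, where `φ` is the root of unity number `x`. -/
def phaseMul {n : ℕ} (x : Fin (2 ^ n)) (V : QUnitary n) : QUnitary n :=
  ⟨rootPhase n x • (V : QMatrix n), by
    rw [Matrix.mem_unitaryGroup_iff, star_smul, Matrix.smul_mul, Matrix.mul_smul, smul_smul,
      rootPhase_mul_star, one_smul]
    exact Matrix.mem_unitaryGroup_iff.mp V.2⟩

/-- The `n` binary digits of `x`, least significant first. -/
def bits (n : ℕ) (x : Fin (2 ^ n)) : List Bool := List.ofFn fun i : Fin n => (x : ℕ).testBit i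

theorem bits_injective (n : ℕ) : Function.Injective (bits n) := by
  intro x y h
  have h' := List.ofFn_injective h
  apply Fin.ext
  apply Nat.eq_of_testBit_eq
  intro i
  by_cases hi : i < n
  · exact congrFun h' ⟨i, hi⟩
  · have hp : 2 ^ n ≤ 2 ^ i := Nat.pow_le_pow_right (by norm_num) (not_lt.mp hi)
    rw [Nat.testBit_lt_two_pow (x.2.trans_le hp), Nat.testBit_lt_two_pow (y.2.trans_le hp)]

/-- The family `𝒰⁺`: keys are pairs of a key `k` and a `2^n`-th root of unity `φ` (given by its
number `x`, and written in front of `k` with `n` bits), and the unitary is `φ · U_{n,k}`. -/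
def UnitaryFamily.withPhase (𝒰 : UnitaryFamily) : UnitaryFamily where
  Key n := 𝒰.Key n × Fin (2 ^ n)
  fintypeKey _ := inferInstance
  nonemptyKey _ := inferInstance
  encode n kx := bits n kx.2 ++ 𝒰.encode n kx.1
  encode_injective n := by
    rintro ⟨k, x⟩ ⟨l, y⟩ h
    obtain ⟨h1, h2⟩ := List.append_inj h (by simp [bits])
    rw [Prod.mk.injEq]
    exact ⟨𝒰.encode_injective n h2, bits_injective n h1⟩
  unitary n kx := phaseMul kx.2 (𝒰.unitary n kx.1)

end PRU

end

noncomputable section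

namespace PRU

open Filter MeasureTheory

/-! ## Linear semantics of circuits -/

/-! Fix a unitary `V` and a circuit whose queries are all controlled. When the oracle is `φ • V`,
the control-one part of a query gains a factor `φ` (for U and Uᵀ) or `φ⁻¹` (for U† and U*), and the
control-zero part gains none. So the final state is a sum of terms `φ ^ (k - m) • A k`, where the `A
k` do not depend on `φ` and there is at most one more term than there are queries. If there are at
most `2 ^ n` terms, Parseval's identity over the `2 ^ n`-th roots of unity (`sum_norm_sq_rootPhase`)
turns the average acceptance probability into the sum over `k` of the squared norms of the accepting
parts of the `A k`.

The same sum is the acceptance probability of a circuit with uncontrolled queries to `V` alone. When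
the control is off, the query is diverted to one half of an ancilla state ∑ (V^j)_{yx} |y⟩|x⟩, which
is maximally entangled at the start (j = 0). Applying V or V† to the first half, or Vᵀ or V* to the
second, only changes j by one. Hence a controlled query of some form is simulated by the
uncontrolled query of that very form, which is why every subset `S` is allowed. A counter records
`k`, and the exponent is always `N - k`, so the ancillas carry no information beyond `k`. The
simulated state is thus a sum over `k` of orthogonal terms, each of them `A k` next to an ancilla
state whose norm does not depend on `k`. `exists_expansion` produces both expansions with the same
`A k`; `sum_acceptProb_phase` compares the probabilities.

This identity holds for each `V`, so it applies to keyed and to Haar-random unitaries alike. In the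
Haar case, averaging over `φ` changes nothing, by invariance of the measure. The two distinguishing
advantages are therefore equal as soon as the number of queries is below `2 ^ n`
(`keyAcceptProb_withPhase`, `haarAcceptProb_simulate`). `isEfficientOracleCircuit_simulate` shows
that the simulation takes polynomial time with the same advice. Efficient generation only needs an
additional global phase, realised exactly by phase gates. -/

theorem extend_ket (f : Finset Wire → State) (s : Finset Wire) : extend f (ket s) = f s := by
  simp [extend, ket]

theorem hom_ext_ket {f g : State →ₗ[ℂ] State} (h : ∀ s, f (ket s) = g (ket s)) : f = g := by
  refine Finsupp.lhom_ext' fun s => LinearMap.ext_ring ?_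
  simpa [ket] using h s

/-- Running a circuit, as a linear map. -/
def runLin {n : ℕ} (V : QMatrix n) : Circuit → State →ₗ[ℂ] State
  | [] => LinearMap.id
  | g :: c => runLin V c ∘ₗ extend (g.onBasis V)

theorem runCircuit_eq_runLin {n : ℕ} (V : QMatrix n) (c : Circuit) (ψ : State) :
    runCircuit V c ψ = runLin V c ψ := by
  induction c generalizing ψ with
  | nil => rfl
  | cons g c ih => exact ih _

theorem runLin_nil {n : ℕ} (V : QMatrix n) (ψ : State) : runLin V [] ψ = ψ := rfl

theorem runLin_cons {n : ℕ} (V : QMatrix n) (g : Gate ℕ) (c : Circuit) (ψ : State) :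
    runLin V (g :: c) ψ = runLin V c (extend (g.onBasis V) ψ) := rfl

theorem runLin_append {n : ℕ} (V : QMatrix n) (c d : Circuit) (ψ : State) :
    runLin V (c ++ d) ψ = runLin V d (runLin V c ψ) := by
  induction c generalizing ψ with
  | nil => rfl
  | cons g c ih => exact ih _

theorem mem_flip (w a : Wire) (s : Finset Wire) : w ∈ flip a s ↔ ¬ (w ∈ s ↔ w = a) := by
  simp only [flip, Finset.mem_symmDiff, Finset.mem_singleton]
  tauto

/-! ## Blocks of qubits -/

/-- The bit string `y` written on array `a`. -/
def block {n : ℕ} (a : ℕ) (y : Fin n → Bool) : Finset Wire :=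
  (Finset.univ.filter fun i => y i = true).image fun i : Fin n => (a, (i : ℕ))

theorem mem_block {n : ℕ} (a : ℕ) (y : Fin n → Bool) (b i : ℕ) :
    (b, i) ∈ block a y ↔ b = a ∧ ∃ h : i < n, y ⟨i, h⟩ = true := by
  simp only [block, Finset.mem_image, Finset.mem_filter, Finset.mem_univ, true_and, Prod.mk.injEq]
  constructor
  · rintro ⟨j, hj, rfl, rfl⟩
    exact ⟨rfl, j.2, hj⟩
  · rintro ⟨rfl, h, hy⟩
    exact ⟨⟨i, h⟩, hy, rfl, rfl⟩

theorem mem_writeTarget {n : ℕ} (y : Fin n → Bool) (s : Finset Wire) (a i : ℕ) :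
    (a, i) ∈ writeTarget n y s ↔
      ((a, i) ∈ s ∧ ¬ (a = 0 ∧ i < n)) ∨ (a = 0 ∧ ∃ h : i < n, y ⟨i, h⟩ = true) := by
  have := mem_block 0 y a i
  unfold block at this
  simp only [writeTarget, Finset.mem_union, this, Finset.mem_filter]

/-- The basis state `s` on the arrays below `M`, together with `y` on array `M`, `x` on array
`M + 1`, and the positions in `T` set on array `M + 2`. -/
def attach {n : ℕ} (M : ℕ) (y x : Fin n → Bool) (T : Finset ℕ) (s : Finset Wire) : Finset Wire :=
  (s.filter fun w => w.1 < M) ∪ block M y ∪ block (M + 1) x ∪ T.image fun i => (M + 2, i)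

theorem mem_attach {n : ℕ} (M : ℕ) (y x : Fin n → Bool) (T : Finset ℕ) (s : Finset Wire)
    (a i : ℕ) : (a, i) ∈ attach M y x T s ↔
      (a < M ∧ (a, i) ∈ s) ∨ (a = M ∧ ∃ h : i < n, y ⟨i, h⟩ = true) ∨
        (a = M + 1 ∧ ∃ h : i < n, x ⟨i, h⟩ = true) ∨ (a = M + 2 ∧ i ∈ T) := by
  simp only [attach, Finset.mem_union, mem_block, Finset.mem_filter, Finset.mem_image,
    Prod.mk.injEq]
  constructor
  · rintro (((⟨h, h'⟩ | h) | h) | ⟨j, hj, rfl, rfl⟩)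
    · exact Or.inl ⟨h', h⟩
    · exact Or.inr (Or.inl h)
    · exact Or.inr (Or.inr (Or.inl h))
    · exact Or.inr (Or.inr (Or.inr ⟨rfl, hj⟩))
  · rintro (⟨h, h'⟩ | h | h | ⟨rfl, h⟩)
    · exact Or.inl (Or.inl (Or.inl ⟨h', h⟩))
    · exact Or.inl (Or.inl (Or.inr h))
    · exact Or.inl (Or.inr h)
    · exact Or.inr ⟨i, h, rfl, rfl⟩

theorem mem_attach_of_lt {n : ℕ} {M : ℕ} (y x : Fin n → Bool) (T : Finset ℕ) (s : Finset Wire)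
    {w : Wire} (hw : w.1 < M) : w ∈ attach M y x T s ↔ w ∈ s := by
  obtain ⟨a, i⟩ := w
  simp only at hw
  rw [mem_attach]
  constructor
  · rintro (h | h | h | h)
    · exact h.2
    all_goals omega
  · exact fun h => Or.inl ⟨hw, h⟩

/-- Two sets of wires with the same qubits below `M` have the same attachments. -/
theorem eq_attach {n : ℕ} {M : ℕ} {y x : Fin n → Bool} {T : Finset ℕ} {s s' : Finset Wire}
    (h0 : ∀ a i, a < M → ((a, i) ∈ s' ↔ (a, i) ∈ s))
    (h1 : ∀ i, (M, i) ∈ s' ↔ ∃ h : i < n, y ⟨i, h⟩ = true)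
    (h2 : ∀ i, (M + 1, i) ∈ s' ↔ ∃ h : i < n, x ⟨i, h⟩ = true)
    (h3 : ∀ i, (M + 2, i) ∈ s' ↔ i ∈ T)
    (h4 : ∀ a i, M + 2 < a → (a, i) ∉ s') : s' = attach M y x T s := by
  ext ⟨a, i⟩
  rw [mem_attach]
  rcases lt_trichotomy a M with h | h | h
  · rw [h0 a i h]
    have e1 : a ≠ M := by omega
    have e2 : a ≠ M + 1 := by omega
    have e3 : a ≠ M + 2 := by omega
    simp [h, e1, e2, e3]
  · subst h
    simp [h1]
  · rcases Nat.lt_trichotomy a (M + 2) with h' | h' | h'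
    · obtain rfl : a = M + 1 := by omega
      simp [h2]
    · subst h'
      simp [h3]
    · have := h4 a i h'
      have e0 : ¬ a < M := by omega
      have e1 : a ≠ M := by omega
      have e2 : a ≠ M + 1 := by omega
      have e3 : a ≠ M + 2 := by omega
      simp [this, e0, e1, e2, e3]

/-! ## Swaps and counters -/

/-- `f (v - 1)`, …, `f 0`, one after the other. -/
def descend (f : ℕ → Circuit) : ℕ → Circuit
  | 0 => []
  | v + 1 => f v ++ descend f v

/-- Swap of `(0, i)` and `(d, i)`, controlled by `(1, 0)`. -/
def ctrlSwap (d i : ℕ) : Circuit :=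
  [.cnot (d, i) (0, i), .toffoli (1, 0) (0, i) (d, i), .cnot (d, i) (0, i)]

/-- Exchange the qubits of arrays `0` and `d` at the positions below `v`. -/
def swapSet (d : ℕ) : ℕ → Finset Wire → Finset Wire
  | 0, s => s
  | v + 1, s => swapSet d v (s.map (Equiv.swap (0, v) (d, v)).toEmbedding)

theorem mem_swapSet {d : ℕ} (hd : d ≠ 0) (v : ℕ) (s : Finset Wire) (a i : ℕ) :
    (a, i) ∈ swapSet d v s ↔
      if a = 0 ∧ i < v then (d, i) ∈ s else if a = d ∧ i < v then (0, i) ∈ s else (a, i) ∈ s := by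
  induction v generalizing s with
  | zero => simp [swapSet]
  | succ v ih =>
    simp only [swapSet, ih, Finset.mem_map_equiv, Equiv.symm_swap, Equiv.swap_apply_def,
      Prod.mk.injEq]
    rcases lt_trichotomy i v with h | h | h
    · have h1 : i ≠ v := by omega
      have h2 : i < v + 1 := by omega
      simp [h, h1, h2]
    · subst h
      by_cases h0 : a = 0
      · simp [h0]
      · by_cases h1 : a = d
        · simp [h1, hd]
        · simp [h0, h1]
    · have h1 : i ≠ v := by omega
      have h2 : ¬ i < v + 1 := by omega
      have h3 : ¬ i < v := by omega
      simp [h1, h2, h3]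

/-- If the control is off, the two CNOTs cancel. If it is on, the three gates are the usual
three-CNOT swap. -/
theorem runLin_controlled_swap {n : ℕ} (V : QMatrix n) (a b c : Wire) (hab : a ≠ b) (hca : c ≠ a)
    (hcb : c ≠ b) (s : Finset Wire) :
    runLin V [.cnot a b, .toffoli c b a, .cnot a b] (ket s) =
      ket (if c ∈ s then s.map (Equiv.swap b a).toEmbedding else s) := by
  have key : ∀ t : Finset Wire, (∀ w, w ∈ t ↔ Equiv.swap b a w ∈ s) →
      t = s.map (Equiv.swap b a).toEmbedding := fun t ht => by
    ext w
    rw [Finset.mem_map_equiv, ht, Equiv.symm_swap]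
  by_cases ha : a ∈ s <;> by_cases hb : b ∈ s <;> by_cases hc : c ∈ s <;>
    simp [runLin_cons, runLin_nil, extend_ket, Gate.onBasis, ha, hb, hc, hab, hab.symm, hca,
      hcb, mem_flip]
  all_goals
    congr 1
    first
    | apply key
      intro w
      by_cases hwa : w = a
      · subst hwa
        simp [mem_flip, ha, hb, hab]
      · by_cases hwb : w = b
        · subst hwb
          simp [mem_flip, ha, hb, hab.symm]
        · simp [mem_flip, hwa, hwb, Equiv.swap_apply_of_ne_of_ne hwb hwa]
    | ext w
      by_cases hwb : w = b
      · subst hwb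
        simp [mem_flip, hb]
      · simp [mem_flip, hwb]

theorem runLin_descend_ctrlSwap {n : ℕ} (V : QMatrix n) {d : ℕ} (hd : 1 < d) (v : ℕ)
    (s : Finset Wire) :
    runLin V (descend (ctrlSwap d) v) (ket s) =
      ket (if ((1, 0) : Wire) ∈ s then swapSet d v s else s) := by
  have hd0 : d ≠ 0 := by omega
  have hd1 : d ≠ 1 := by omega
  induction v generalizing s with
  | zero => simp [descend, swapSet, runLin_nil]
  | succ v ih =>
    rw [descend, runLin_append, ctrlSwap, runLin_controlled_swap V _ _ _ (by simp [hd0])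
      (by simp [hd1.symm]) (by simp), ih]
    by_cases h : ((1, 0) : Wire) ∈ s
    · have : ((1, 0) : Wire) ∈ s.map (Equiv.swap (0, v) (d, v)).toEmbedding := by
        rw [Finset.mem_map_equiv, Equiv.symm_swap, Equiv.swap_apply_of_ne_of_ne] <;>
          simp [h, hd1.symm]
      simp only [h, this, if_true, swapSet]
    · simp only [h, if_false]

/-- A gate of the counter. -/
def counterGate (C v : ℕ) : Circuit := [.toffoli (1, 0) (C, v) (C, v + 1)]

/-- The counter `T` becomes the symmetric difference of `T` and `T + 1`. As a polynomial over the
field with two elements, it is multiplied by `1 + X`. -/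
def counterStep (T : Finset ℕ) : Finset ℕ := symmDiff T (T.image Nat.succ)

/-- The value of the counter after `k` steps, starting from `{0}`. -/
def counter (k : ℕ) : Finset ℕ := counterStep^[k] {0}

theorem counter_succ (k : ℕ) : counter (k + 1) = counterStep (counter k) :=
  Function.iterate_succ_apply' _ _ _

/-- The counter is the support of `(1 + X) ^ k` over the field with two elements, a polynomial of
degree `k`. Having the degree as maximum is all that is needed to tell different values apart, and
incrementing requires no carries. -/
theorem counter_max (k : ℕ) : k ∈ counter k ∧ ∀ i ∈ counter k, i ≤ k := by
  induction k with
  | zero => simp [counter]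
  | succ k ih =>
    rw [counter_succ, counterStep]
    constructor
    · rw [Finset.mem_symmDiff]
      refine Or.inr ⟨Finset.mem_image_of_mem _ ih.1, fun h => ?_⟩
      have := ih.2 _ h
      omega
    · intro i hi
      rw [Finset.mem_symmDiff] at hi
      rcases hi with ⟨h, -⟩ | ⟨h, -⟩
      · have := ih.2 _ h
        omega
      · obtain ⟨j, hj, rfl⟩ := Finset.mem_image.mp h
        have := ih.2 _ hj
        omega

theorem counter_injective : Function.Injective counter := by
  intro k l h
  have h1 := (counter_max l).2 k (h ▸ (counter_max k).1)
  have h2 := (counter_max k).2 l (h.symm ▸ (counter_max l).1)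
  omega

/-- The gates run from the highest position downwards, so each Toffoli reads its source before that
source is itself modified. All flips are therefore expressed through the original `s`. -/
theorem runLin_descend_counterGate {n : ℕ} (V : QMatrix n) {C : ℕ} (hC : 1 < C) (v : ℕ)
    (s : Finset Wire) :
    ∃ s', runLin V (descend (counterGate C) v) (ket s) = ket s' ∧
      ∀ a i, (a, i) ∈ s' ↔ ¬ ((a, i) ∈ s ↔
        (((1, 0) : Wire) ∈ s ∧ a = C ∧ 1 ≤ i ∧ i ≤ v ∧ (C, i - 1) ∈ s)) := by
  have hC1 : C ≠ 1 := by omega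
  induction v generalizing s with
  | zero =>
    refine ⟨s, rfl, fun a i => ?_⟩
    have : ¬ (1 ≤ i ∧ i ≤ 0) := by omega
    tauto
  | succ v ih =>
    rw [descend, runLin_append, counterGate, runLin_cons, runLin_nil, extend_ket, Gate.onBasis]
    by_cases h : ((1, 0) : Wire) ∈ s ∧ ((C, v) : Wire) ∈ s
    · rw [if_pos ⟨by simp [hC1.symm], h⟩]
      obtain ⟨s', h1, h2⟩ := ih (flip (C, v + 1) s)
      refine ⟨s', h1, fun a i => ?_⟩
      rw [h2]
      simp only [mem_flip, Prod.mk.injEq, hC1.symm, false_and, iff_false, not_not, h.1, true_and]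
      by_cases ha : a = C
      · subst ha
        simp only [true_and]
        rcases lt_trichotomy i (v + 1) with hi | hi | hi
        · have e1 : i ≠ v + 1 := by omega
          have e2 : i - 1 ≠ v + 1 := by omega
          have e3 : i ≤ v ↔ i ≤ v + 1 := by omega
          simp [e1, e2, e3]
        · subst hi
          simp [h.2]
        · have e1 : i ≠ v + 1 := by omega
          have e2 : ¬ i ≤ v + 1 := by omega
          have e3 : ¬ i ≤ v := by omega
          simp [e1, e2, e3]
      · simp [ha]
    · rw [if_neg (fun h' => h h'.2)]
      obtain ⟨s', h1, h2⟩ := ih s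
      refine ⟨s', h1, fun a i => ?_⟩
      rw [h2]
      by_cases hi : i = v + 1
      · subst hi
        simp only [Nat.add_sub_cancel]
        have : ¬ (v + 1 ≤ v) := by omega
        tauto
      · have : i ≤ v ↔ i ≤ v + 1 := by omega
        rw [this]

theorem runLin_descend_counterGate_attach {n : ℕ} (V : QMatrix n) {M : ℕ} (hM : 1 < M) (v : ℕ)
    (y x : Fin n → Bool) (T : Finset ℕ) (s : Finset Wire) (hT : ∀ i ∈ T, i < v) :
    runLin V (descend (counterGate (M + 2)) v) (ket (attach M y x T s)) =
      ket (attach M y x (if ((1, 0) : Wire) ∈ s then counterStep T else T) s) := by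
  obtain ⟨s', h1, h2⟩ := runLin_descend_counterGate V (C := M + 2) (by omega) v (attach M y x T s)
  rw [h1]
  congr 1
  simp only [mem_attach_of_lt y x T s (w := ((1, 0) : Wire)) hM] at h2
  apply eq_attach
  · intro a i ha
    have : a ≠ M + 2 := by omega
    rw [h2, mem_attach_of_lt y x T s (w := (a, i)) ha]
    simp [this]
  · intro i
    rw [h2, mem_attach]
    simp
  · intro i
    rw [h2, mem_attach]
    simp
  · intro i
    rw [h2, mem_attach, mem_attach]
    have e1 : ¬ (M + 2 < M) := by omega
    simp only [e1, false_and, Nat.add_eq_left, OfNat.ofNat_ne_zero, Nat.add_left_cancel_iff,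
      OfNat.ofNat_ne_one, true_and, false_or]
    by_cases h : ((1, 0) : Wire) ∈ s
    · simp only [h, true_and, if_true, counterStep, Finset.mem_symmDiff, Finset.mem_image]
      have : (1 ≤ i ∧ i ≤ v ∧ i - 1 ∈ T) ↔ ∃ a ∈ T, a.succ = i := by
        constructor
        · rintro ⟨h1, h2, h3⟩
          exact ⟨i - 1, h3, by omega⟩
        · rintro ⟨a, ha, rfl⟩
          have := hT a ha
          exact ⟨by omega, by omega, by simpa using ha⟩
      rw [this]
      by_cases h1 : i ∈ T <;> by_cases h2 : ∃ a ∈ T, a.succ = i <;> simp [h1, h2]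
    · simp [h]
  · intro a i ha
    rw [h2, mem_attach]
    have e0 : ¬ a < M := by omega
    have e1 : a ≠ M := by omega
    have e2 : a ≠ M + 1 := by omega
    have e3 : a ≠ M + 2 := by omega
    simp [e0, e1, e2, e3]

/-! ## Gates next to attached registers -/

theorem flip_flip (a : Wire) (s : Finset Wire) : flip a (flip a s) = s := by
  ext w
  simp only [mem_flip]
  tauto

/-- The bit strings `y`, `x` and the counter `T`, attached to a state. -/
def attachLin {n : ℕ} (M : ℕ) (y x : Fin n → Bool) (T : Finset ℕ) : State →ₗ[ℂ] State :=
  extend fun s => ket (attach M y x T s)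

theorem attachLin_ket {n : ℕ} (M : ℕ) (y x : Fin n → Bool) (T : Finset ℕ) (s : Finset Wire) :
    attachLin M y x T (ket s) = ket (attach M y x T s) := extend_ket _ _

/-- The gate only concerns arrays below `M`. -/
def Gate.ArraysLT (M : ℕ) {ι : Type} : Gate ι → Prop
  | .not a => a.1 < M
  | .cnot a b => a.1 < M ∧ b.1 < M
  | .toffoli a b c => a.1 < M ∧ b.1 < M ∧ c.1 < M
  | .hadamard a => a.1 < M
  | .phase _ a => a.1 < M
  | .query _ => 1 < M

theorem attach_congr_of_lt {n : ℕ} {M : ℕ} {y x : Fin n → Bool} {T : Finset ℕ}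
    {s s' t : Finset Wire} (h : ∀ w, w ∈ s' ↔ if w.1 < M then w ∈ t else w ∈ attach M y x T s) :
    s' = attach M y x T t := by
  apply eq_attach
  · intro a i ha
    simp [h, ha]
  · intro i
    simp [h, mem_attach]
  · intro i
    simp [h, mem_attach]
  · intro i
    simp [h, mem_attach]
  · intro a i ha
    have e0 : ¬ a < M := by omega
    have e1 : a ≠ M := by omega
    have e2 : a ≠ M + 1 := by omega
    have e3 : a ≠ M + 2 := by omega
    simp [h, mem_attach, e0, e1, e2, e3]

theorem flip_attach {n : ℕ} {M : ℕ} (y x : Fin n → Bool) (T : Finset ℕ) (s : Finset Wire)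
    {a : Wire} (ha : a.1 < M) : flip a (attach M y x T s) = attach M y x T (flip a s) := by
  refine attach_congr_of_lt (s := s) fun w => ?_
  split_ifs with hw
  · rw [mem_flip, mem_flip, mem_attach_of_lt _ _ _ _ hw]
  · have : w ≠ a := by
      rintro rfl
      exact hw ha
    simp [mem_flip, this]

theorem insert_attach {n : ℕ} {M : ℕ} (y x : Fin n → Bool) (T : Finset ℕ) (s : Finset Wire)
    {a : Wire} (ha : a.1 < M) : insert a (attach M y x T s) = attach M y x T (insert a s) := by
  refine attach_congr_of_lt (s := s) fun w => ?_
  split_ifs with hw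
  · rw [Finset.mem_insert, Finset.mem_insert, mem_attach_of_lt _ _ _ _ hw]
  · have : w ≠ a := by
      rintro rfl
      exact hw ha
    simp [this]

theorem erase_attach {n : ℕ} {M : ℕ} (y x : Fin n → Bool) (T : Finset ℕ) (s : Finset Wire)
    {a : Wire} (ha : a.1 < M) : (attach M y x T s).erase a = attach M y x T (s.erase a) := by
  refine attach_congr_of_lt (s := s) fun w => ?_
  split_ifs with hw
  · rw [Finset.mem_erase, Finset.mem_erase, mem_attach_of_lt _ _ _ _ hw]
  · have : w ≠ a := by
      rintro rfl
      exact hw ha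
    simp [this]

theorem writeTarget_attach {n k : ℕ} {M : ℕ} (hM : 0 < M) (y x : Fin n → Bool) (T : Finset ℕ)
    (s : Finset Wire) (z : Fin k → Bool) :
    writeTarget k z (attach M y x T s) = attach M y x T (writeTarget k z s) := by
  refine attach_congr_of_lt (s := s) fun w => ?_
  obtain ⟨a, i⟩ := w
  split_ifs with hw
  · rw [mem_writeTarget, mem_writeTarget, mem_attach_of_lt _ _ _ _ hw]
  · have : a ≠ 0 := by
      rintro rfl
      exact hw hM
    simp [mem_writeTarget, this]

theorem readTarget_attach {n k : ℕ} {M : ℕ} (hM : 0 < M) (y x : Fin n → Bool) (T : Finset ℕ)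
    (s : Finset Wire) : readTarget k (attach M y x T s) = readTarget k s := by
  funext i
  simp only [readTarget, mem_attach_of_lt y x T s (w := ((0, (i : ℕ)) : Wire)) hM]

theorem applyTarget_attach {n k : ℕ} {M : ℕ} (hM : 0 < M) (y x : Fin n → Bool) (T : Finset ℕ)
    (s : Finset Wire) (V : QMatrix k) :
    applyTarget V (attach M y x T s) = attachLin M y x T (applyTarget V s) := by
  simp only [applyTarget, map_sum, map_smul, attachLin_ket, readTarget_attach hM,
    writeTarget_attach hM]

/-- A gate on arrays below `M` neither reads nor writes the attached arrays. Queries touch arrays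
`0` and `1`, which is the reason for `1 < M` in `Gate.ArraysLT`. -/
theorem onBasis_attach {n k : ℕ} {M : ℕ} (y x : Fin n → Bool) (T : Finset ℕ) (V : QMatrix k)
    (g : Gate ℕ) (hg : g.ArraysLT M) (s : Finset Wire) :
    g.onBasis V (attach M y x T s) = attachLin M y x T (g.onBasis V s) := by
  cases g with
  | not a => simp only [Gate.onBasis, attachLin_ket, flip_attach _ _ _ _ hg]
  | cnot a b =>
    simp only [Gate.onBasis, mem_attach_of_lt _ _ _ _ hg.1, flip_attach _ _ _ _ hg.2]
    split_ifs <;> rw [attachLin_ket]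
  | toffoli a b c =>
    simp only [Gate.onBasis, mem_attach_of_lt _ _ _ _ hg.1, mem_attach_of_lt _ _ _ _ hg.2.1,
      flip_attach _ _ _ _ hg.2.2]
    split_ifs <;> rw [attachLin_ket]
  | hadamard a =>
    simp only [Gate.onBasis, mem_attach_of_lt _ _ _ _ hg, map_smul, map_add, attachLin_ket,
      insert_attach _ _ _ _ hg, erase_attach _ _ _ _ hg]
  | phase j a =>
    simp only [Gate.onBasis, mem_attach_of_lt _ _ _ _ hg]
    split_ifs <;> simp only [map_smul, attachLin_ket]
  | query q =>
    have hM : 0 < M := lt_trans zero_lt_one hg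
    cases q with
    | uncontrolled o => exact applyTarget_attach hM _ _ _ _ _
    | controlled o =>
      simp only [Gate.onBasis, mem_attach_of_lt y x T s (w := ((1, 0) : Wire)) hg]
      split_ifs
      · exact applyTarget_attach hM _ _ _ _ _
      · rw [attachLin_ket]

theorem extend_onBasis_attachLin {n k : ℕ} {M : ℕ} (y x : Fin n → Bool) (T : Finset ℕ)
    (V : QMatrix k) (g : Gate ℕ) (hg : g.ArraysLT M) (ψ : State) :
    extend (g.onBasis V) (attachLin M y x T ψ) = attachLin M y x T (extend (g.onBasis V) ψ) := by
  have : extend (g.onBasis V) ∘ₗ attachLin M y x T = attachLin M y x T ∘ₗ extend (g.onBasis V) :=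
    hom_ext_ket fun s => by
      simp only [LinearMap.comp_apply, attachLin_ket, extend_ket, onBasis_attach _ _ _ _ _ hg]
  exact LinearMap.congr_fun this ψ

/-! ## Simulation of a controlled query -/

/-- The part of a controlled query in which the control qubit is `1`. -/
def onPart {n : ℕ} (V : QMatrix n) : State →ₗ[ℂ] State :=
  extend fun s => if ((1, 0) : Wire) ∈ s then applyTarget V s else 0

/-- The part of a controlled query in which the control qubit is `0`. -/
def offPart : State →ₗ[ℂ] State :=
  extend fun s => if ((1, 0) : Wire) ∈ s then 0 else ket s

/-- Whether `φ • V` is accessed with a factor `φ`, rather than its inverse. -/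
def QueryOp.positive : QueryOp → Bool
  | plain => true
  | adjoint => false
  | conj => false
  | transpose => true

/-- Whether the idle query acts on the first half of the entangled state. -/
def QueryOp.left : QueryOp → Bool
  | plain => true
  | adjoint => true
  | conj => false
  | transpose => false

/-- Query if the control qubit is `0`; otherwise, query on array `d`. -/
def redirect (d n : ℕ) (o : QueryOp) : Circuit :=
  descend (ctrlSwap d) n ++ [.not (1, 0), .query (.uncontrolled o), .not (1, 0)] ++
    descend (ctrlSwap d) n ++ [.not (1, 0)]

theorem not_mem_flip_self (a : Wire) (s : Finset Wire) : a ∈ flip a s ↔ a ∉ s := by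
  simp [mem_flip]

/-- The control enters inverted, so neither swap fires. The uncontrolled query ignores the control
qubit; the NOTs around it merely make the state at the query literally `s`. -/
theorem runLin_redirect_on {n : ℕ} (V : QMatrix n) {d : ℕ} (hd : 1 < d) (o : QueryOp)
    (s : Finset Wire) (hs : ((1, 0) : Wire) ∈ s) :
    runLin V (redirect d n o) (ket (flip (1, 0) s)) = applyTarget (o.apply V) s := by
  have h1 : ((1, 0) : Wire) ∉ flip (1, 0) s := by simp [not_mem_flip_self, hs]
  have h2 : ∀ z, ((1, 0) : Wire) ∉ flip (1, 0) (writeTarget n z s) := fun z => by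
    rw [not_mem_flip_self, mem_writeTarget]
    simp [hs]
  simp only [redirect, runLin_append, runLin_descend_ctrlSwap V hd, if_neg h1, runLin_cons,
    runLin_nil, extend_ket, Gate.onBasis, flip_flip, applyTarget, map_sum, map_smul, if_neg (h2 _)]

/-- Both swaps fire and conjugate the query from array `0` to array `d`. The resulting basis states
are given by a membership condition, so that callers can supply an `attach` with one bit string
replaced. -/
theorem runLin_redirect_off {n : ℕ} (V : QMatrix n) {d : ℕ} (hd : 1 < d) (o : QueryOp)
    (s : Finset Wire) (hs : ((1, 0) : Wire) ∉ s) (f : (Fin n → Bool) → Finset Wire)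
    (hf : ∀ z a i, (a, i) ∈ f z ↔
      if a = d ∧ i < n then ∃ h : i < n, z ⟨i, h⟩ = true else (a, i) ∈ s) :
    runLin V (redirect d n o) (ket (flip (1, 0) s)) =
      ∑ z, o.apply V z (fun i => decide ((d, (i : ℕ)) ∈ s)) • ket (f z) := by
  have hd0 : d ≠ 0 := by omega
  have hd1 : d ≠ 1 := by omega
  have h1 : ((1, 0) : Wire) ∈ flip (1, 0) s := by simp [not_mem_flip_self, hs]
  have h2 : ∀ t : Finset Wire, ((1, 0) : Wire) ∈ swapSet d n t ↔ ((1, 0) : Wire) ∈ t := fun t => by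
    rw [mem_swapSet hd0]
    simp [hd1.symm]
  have h3 : ∀ z, ((1, 0) : Wire) ∈ flip (1, 0) (writeTarget n z (flip (1, 0)
      (swapSet d n (flip (1, 0) s)))) := fun z => by
    simp [not_mem_flip_self, mem_writeTarget, h2, hs]
  have h4 : readTarget n (flip (1, 0) (swapSet d n (flip (1, 0) s))) =
      fun i : Fin n => decide ((d, (i : ℕ)) ∈ s) := by
    funext i
    simp [readTarget, mem_flip, mem_swapSet hd0, hd1]
  simp only [redirect, runLin_append, runLin_descend_ctrlSwap V hd, if_pos h1, runLin_cons,
    runLin_nil, extend_ket, Gate.onBasis, applyTarget, map_sum, map_smul, if_pos (h3 _), h4]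
  refine Finset.sum_congr rfl fun z _ => ?_
  congr 2
  ext ⟨a, i⟩
  rw [hf]
  by_cases h10 : (a, i) = ((1, 0) : Wire)
  · obtain ⟨rfl, rfl⟩ := Prod.mk.inj h10
    simp [mem_flip, mem_swapSet hd0, hd1.symm, hs, mem_writeTarget]
  · by_cases hi : i < n
    · by_cases ha : a = d
      · subst ha
        simp [mem_flip, mem_swapSet hd0, hd1, hi, mem_writeTarget, hd0]
      · by_cases ha0 : a = 0
        · subst ha0
          simp [mem_flip, mem_swapSet hd0, hd1, hi, mem_writeTarget, hd0, hd0.symm]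
        · have h1i : ¬ (a = 1 ∧ i = 0) := by simpa using h10
          simp [mem_flip, mem_swapSet hd0, h1i, ha, ha0, mem_writeTarget]
    · have h1i : ¬ (a = 1 ∧ i = 0) := by simpa using h10
      simp [mem_flip, mem_swapSet hd0, h1i, hi, mem_writeTarget]

/-- Simulation of a controlled query, when the counter has values below `v`. -/
def gadget (M n v : ℕ) (o : QueryOp) : Circuit :=
  (if o.positive then descend (counterGate (M + 2)) v ++ [.not (1, 0)]
    else [.not (1, 0)] ++ descend (counterGate (M + 2)) v) ++
  redirect (if o.left then M else M + 1) n o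

/-- Placing the counter before or after the NOT lets its Toffoli gates see the control qubit or its
negation. Thus it advances on the control-one branch for positive queries and on the control-zero
branch for the others, and never has to decrease. -/
theorem runLin_counter_not {n : ℕ} (V : QMatrix n) {M : ℕ} (hM : 1 < M) (v : ℕ) (o : QueryOp)
    (y x : Fin n → Bool) (T : Finset ℕ) (s : Finset Wire) (hT : ∀ i ∈ T, i < v) :
    runLin V (if o.positive then descend (counterGate (M + 2)) v ++ [.not (1, 0)]
      else [.not (1, 0)] ++ descend (counterGate (M + 2)) v) (ket (attach M y x T s)) =
    ket (flip (1, 0) (attach M y x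
      (if (((1, 0) : Wire) ∈ s ↔ o.positive = true) then counterStep T else T) s)) := by
  cases o.positive
  · simp only [Bool.false_eq_true, if_false, runLin_append, runLin_cons, runLin_nil, extend_ket,
      Gate.onBasis, iff_false]
    rw [flip_attach _ _ _ _ (show ((1, 0) : Wire).1 < M from hM),
      runLin_descend_counterGate_attach V hM v y x T _ hT,
      flip_attach _ _ _ _ (show ((1, 0) : Wire).1 < M from hM)]
    simp only [not_mem_flip_self]
  · simp only [if_true, runLin_append, runLin_cons, runLin_nil, extend_ket, Gate.onBasis,
      runLin_descend_counterGate_attach V hM v y x T _ hT, iff_true]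

/-- The effect of a gadget: if the control qubit is `1`, the query is applied; if it is `0`, the
query is applied to the first or second attached bit string. -/
theorem runLin_gadget {n : ℕ} (V : QMatrix n) {M : ℕ} (hM : 1 < M) (v : ℕ) (o : QueryOp)
    (y x : Fin n → Bool) (T : Finset ℕ) (hT : ∀ i ∈ T, i < v) (ψ : State) :
    runLin V (gadget M n v o) (attachLin M y x T ψ) =
      attachLin M y x (if o.positive then counterStep T else T) (onPart (o.apply V) ψ) +
      if o.left then
        ∑ z, o.apply V z y • attachLin M z x (if o.positive then T else counterStep T) (offPart ψ)
      else
        ∑ z, o.apply V z x • attachLin M y z (if o.positive then T else counterStep T)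
          (offPart ψ) := by
  have h0 : ∀ s (T : Finset ℕ), ((1, 0) : Wire) ∈ attach M y x T s ↔ ((1, 0) : Wire) ∈ s :=
    fun s T => mem_attach_of_lt _ _ _ _ (show ((1, 0) : Wire).1 < M from hM)
  have key : runLin V (gadget M n v o) ∘ₗ attachLin M y x T =
      attachLin M y x (if o.positive then counterStep T else T) ∘ₗ onPart (o.apply V) +
      if o.left then
        ∑ z, o.apply V z y •
          (attachLin M z x (if o.positive then T else counterStep T) ∘ₗ offPart)
      else
        ∑ z, o.apply V z x •
          (attachLin M y z (if o.positive then T else counterStep T) ∘ₗ offPart) := by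
    refine hom_ext_ket fun s => ?_
    rw [LinearMap.comp_apply, attachLin_ket, gadget, runLin_append,
      runLin_counter_not V hM v o y x T s hT]
    -- On a basis state one of `onPart` and `offPart` vanishes, so only one summand of the claim
    -- remains in each case.
    by_cases hs : ((1, 0) : Wire) ∈ s
    · rw [runLin_redirect_on V (by split_ifs <;> omega) o _ ((h0 _ _).2 hs),
        applyTarget_attach (by omega)]
      cases o.positive <;> cases o.left <;> simp [onPart, offPart, extend_ket, hs]
    · cases hl : o.left
      · rw [runLin_redirect_off V (by simp; omega) o _ (fun h => hs ((h0 _ _).1 h))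
          (fun z => attach M y z
            (if (((1, 0) : Wire) ∈ s ↔ o.positive = true) then counterStep T else T) s)]
        · have e : (fun i : Fin n => decide (((if false = true then M else M + 1), (i : ℕ)) ∈
              attach M y x (if (((1, 0) : Wire) ∈ s ↔ o.positive = true) then counterStep T else T)
                s)) = x := by
            funext i
            simp [mem_attach]
          rw [e]
          cases o.positive <;>
            simp [onPart, offPart, extend_ket, hs, attachLin_ket]
        · intro z a i
          simp only [Bool.false_eq_true, if_false, mem_attach]
          by_cases ha : a = M + 1
          · subst ha
            by_cases hi : i < n <;> simp [hi]
          · simp [ha]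
      · rw [runLin_redirect_off V (by simp; omega) o _ (fun h => hs ((h0 _ _).1 h))
          (fun z => attach M z x
            (if (((1, 0) : Wire) ∈ s ↔ o.positive = true) then counterStep T else T) s)]
        · have e : (fun i : Fin n => decide (((if true = true then M else M + 1), (i : ℕ)) ∈
              attach M y x (if (((1, 0) : Wire) ∈ s ↔ o.positive = true) then counterStep T else T)
                s)) = y := by
            funext i
            simp [mem_attach]
          rw [e]
          cases o.positive <;>
            simp [onPart, offPart, extend_ket, hs, attachLin_ket]
        · intro z a i
          simp only [if_true, mem_attach]
          by_cases ha : a = M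
          · subst ha
            by_cases hi : i < n <;> simp [hi]
          · simp [ha]
  have := LinearMap.congr_fun key ψ
  simp only [LinearMap.comp_apply, LinearMap.add_apply] at this
  rw [this]
  cases o.left <;> simp

/-! ## The entangled state -/

/-- The entangled state `∑ (V^j)_{yx} |y⟩|x⟩`, together with the counter `T`, attached to a
state. -/
def entangled {n : ℕ} (M : ℕ) (V : QUnitary n) (j : ℤ) (T : Finset ℕ) : State →ₗ[ℂ] State :=
  ∑ y, ∑ x, ((V ^ j : QUnitary n) : QMatrix n) y x • attachLin M y x T

theorem entangled_apply {n : ℕ} (M : ℕ) (V : QUnitary n) (j : ℤ) (T : Finset ℕ) (ψ : State) :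
    entangled M V j T ψ =
      ∑ y, ∑ x, ((V ^ j : QUnitary n) : QMatrix n) y x • attachLin M y x T ψ := by
  simp [entangled]

theorem extend_onBasis_entangled {n : ℕ} {M : ℕ} (V : QUnitary n) (j : ℤ) (T : Finset ℕ)
    (W : QMatrix n) (g : Gate ℕ) (hg : g.ArraysLT M) (ψ : State) :
    extend (g.onBasis W) (entangled M V j T ψ) = entangled M V j T (extend (g.onBasis W) ψ) := by
  simp only [entangled_apply, map_sum, map_smul, extend_onBasis_attachLin _ _ _ _ _ hg]

theorem coe_zpow_add_one {n : ℕ} (V : QUnitary n) (j : ℤ) :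
    ((V ^ (j + 1) : QUnitary n) : QMatrix n) = (V ^ j : QUnitary n) * (V : QMatrix n) := by
  rw [zpow_add_one]
  rfl

theorem coe_zpow_one_add {n : ℕ} (V : QUnitary n) (j : ℤ) :
    ((V ^ (j + 1) : QUnitary n) : QMatrix n) = (V : QMatrix n) * (V ^ j : QUnitary n) := by
  rw [add_comm, zpow_one_add]
  rfl

theorem coe_zpow_sub_one {n : ℕ} (V : QUnitary n) (j : ℤ) :
    ((V ^ (j - 1) : QUnitary n) : QMatrix n) =
      (V ^ j : QUnitary n) * (V : QMatrix n).conjTranspose := by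
  rw [zpow_sub_one]
  rfl

theorem coe_zpow_neg_one_add {n : ℕ} (V : QUnitary n) (j : ℤ) :
    ((V ^ (j - 1) : QUnitary n) : QMatrix n) =
      (V : QMatrix n).conjTranspose * (V ^ j : QUnitary n) := by
  rw [sub_eq_neg_add, zpow_add, zpow_neg_one]
  rfl

/-- A query on the first half multiplies the coefficient matrix from the left, by V or V†. -/
theorem sum_apply_mul_left {n : ℕ} (V : QUnitary n) (j : ℤ) (o : QueryOp) (ho : o.left = true)
    (z x : Fin n → Bool) :
    ∑ y, o.apply (V : QMatrix n) z y * ((V ^ j : QUnitary n) : QMatrix n) y x =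
      ((V ^ (if o.positive then j + 1 else j - 1) : QUnitary n) : QMatrix n) z x := by
  cases o with
  | plain =>
    simp only [QueryOp.positive, if_true, coe_zpow_one_add, Matrix.mul_apply, QueryOp.apply]
  | adjoint =>
    simp only [QueryOp.positive, Bool.false_eq_true, if_false, coe_zpow_neg_one_add,
      Matrix.mul_apply, QueryOp.apply]
  | conj => simp [QueryOp.left] at ho
  | transpose => simp [QueryOp.left] at ho

/-- On the second half the matrix acts on the column index, so its transpose multiplies from the
right: Vᵀ contributes V, and V* contributes V†. -/
theorem sum_apply_mul_right {n : ℕ} (V : QUnitary n) (j : ℤ) (o : QueryOp) (ho : o.left = false)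
    (z y : Fin n → Bool) :
    ∑ x, o.apply (V : QMatrix n) z x * ((V ^ j : QUnitary n) : QMatrix n) y x =
      ((V ^ (if o.positive then j + 1 else j - 1) : QUnitary n) : QMatrix n) y z := by
  cases o with
  | transpose =>
    simp only [QueryOp.positive, if_true, coe_zpow_add_one, Matrix.mul_apply, QueryOp.apply,
      Matrix.transpose_apply]
    exact Finset.sum_congr rfl fun x _ => mul_comm _ _
  | conj =>
    simp only [QueryOp.positive, Bool.false_eq_true, if_false, coe_zpow_sub_one,
      Matrix.mul_apply, QueryOp.apply, Matrix.map_apply, Matrix.conjTranspose_apply]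
    exact Finset.sum_congr rfl fun x _ => mul_comm _ _
  | plain => simp [QueryOp.left] at ho
  | adjoint => simp [QueryOp.left] at ho

/-- The branch with control one leaves the exponent alone; the branch with control zero moves it by
one. The counter moves in just one of the two branches, so counter and exponent stay tied together
in a superposition. -/
theorem runLin_gadget_entangled {n : ℕ} (V : QUnitary n) {M : ℕ} (hM : 1 < M) (v : ℕ) (o : QueryOp)
    (j : ℤ) (T : Finset ℕ) (hT : ∀ i ∈ T, i < v) (ψ : State) :
    runLin (V : QMatrix n) (gadget M n v o) (entangled M V j T ψ) =
      entangled M V j (if o.positive then counterStep T else T)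
        (onPart (o.apply (V : QMatrix n)) ψ) +
      entangled M V (if o.positive then j + 1 else j - 1)
        (if o.positive then T else counterStep T) (offPart ψ) := by
  simp only [entangled_apply, map_sum, map_smul, runLin_gadget _ hM v o _ _ T hT, smul_add,
    Finset.sum_add_distrib]
  congr 1
  cases ho : o.left
  · simp only [Bool.false_eq_true, if_false, Finset.smul_sum, smul_smul]
    refine Finset.sum_congr rfl fun y _ => ?_
    rw [Finset.sum_comm]
    refine Finset.sum_congr rfl fun z _ => ?_
    rw [← Finset.sum_smul, ← sum_apply_mul_right V j o ho z y]
    congr 1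
    exact Finset.sum_congr rfl fun x _ => mul_comm _ _
  · simp only [if_true, Finset.smul_sum, smul_smul]
    rw [Finset.sum_comm, Finset.sum_congr rfl fun x _ => Finset.sum_comm, Finset.sum_comm]
    refine Finset.sum_congr rfl fun z _ => Finset.sum_congr rfl fun x _ => ?_
    rw [← Finset.sum_smul, ← sum_apply_mul_left V j o ho z x]
    congr 1
    exact Finset.sum_congr rfl fun x _ => mul_comm _ _

/-! ## Preparation of the entangled state -/

/-- Preparation of an entangled pair of qubits. -/
def entangle (M i : ℕ) : Circuit := [.hadamard (M, i), .cnot (M, i) (M + 1, i)]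

/-- Preparation of the counter and the maximally entangled state. -/
def prepare (M n : ℕ) : Circuit := .not (M + 2, 0) :: descend (entangle M) n

/-- The indicator function of a set of positions. -/
def indicator (n : ℕ) (S : Finset ℕ) : Fin n → Bool := fun i => decide ((i : ℕ) ∈ S)

theorem runLin_entangle {n : ℕ} (W : QMatrix n) (M : ℕ) (T S : Finset ℕ) (s : Finset Wire) (v : ℕ)
    (hv : v < n) (hS : v ∉ S) :
    runLin W (entangle M v) (ket (attach M (indicator n S) (indicator n S) T s)) =
      ((1 / Real.sqrt 2 : ℝ) : ℂ) • (ket (attach M (indicator n S) (indicator n S) T s) +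
        ket (attach M (indicator n (insert v S)) (indicator n (insert v S)) T s)) := by
  have h1 : ((M, v) : Wire) ∉ attach M (indicator n S) (indicator n S) T s := by
    simp [mem_attach, indicator, hS]
  have h2 : ((M, v) : Wire) ≠ (M + 1, v) := by simp
  simp only [entangle, runLin_cons, runLin_nil, extend_ket, Gate.onBasis, map_smul,
    map_add, one_smul, Finset.erase_eq_of_notMem h1, h1, and_false, if_false,
    Finset.mem_insert_self, and_true, ne_eq, h2, not_false_eq_true, if_true]
  congr 3
  apply eq_attach
  · intro a i ha
    rw [mem_flip, Finset.mem_insert, mem_attach]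
    have e0 : a ≠ M := by omega
    have e1 : a ≠ M + 1 := by omega
    have e2 : a ≠ M + 2 := by omega
    simp [e0, e1, e2, ha]
  · intro i
    rw [mem_flip, Finset.mem_insert, mem_attach]
    by_cases hi : i = v
    · subst hi
      simp [indicator, hv]
    · simp [indicator, hi]
  · intro i
    rw [mem_flip, Finset.mem_insert, mem_attach]
    by_cases hi : i = v
    · subst hi
      simp [indicator, hv, hS]
    · simp [indicator, hi]
  · intro i
    rw [mem_flip, Finset.mem_insert, mem_attach]
    simp
  · intro a i ha
    rw [mem_flip, Finset.mem_insert, mem_attach]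
    have e : ¬ a < M := by omega
    have e0 : a ≠ M := by omega
    have e1 : a ≠ M + 1 := by omega
    have e2 : a ≠ M + 2 := by omega
    simp [e0, e1, e2, e]

/-- Each entangled pair doubles the set of basis states. `S` collects the positions already set by
earlier, higher pairs, and `R` ranges over the choices still to come. -/
theorem runLin_descend_entangle {n : ℕ} (W : QMatrix n) (M : ℕ) (T : Finset ℕ) (s : Finset Wire)
    (v : ℕ) (hv : v ≤ n) (S : Finset ℕ) (hS : ∀ i ∈ S, v ≤ i) :
    runLin W (descend (entangle M) v) (ket (attach M (indicator n S) (indicator n S) T s)) =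
      ((1 / Real.sqrt 2 : ℝ) : ℂ) ^ v • ∑ R ∈ (Finset.range v).powerset,
        ket (attach M (indicator n (R ∪ S)) (indicator n (R ∪ S)) T s) := by
  induction v generalizing S with
  | zero => simp [descend, runLin_nil]
  | succ v ih =>
    have hvS : v ∉ S := fun h => by
      have := hS v h
      omega
    rw [descend, runLin_append, runLin_entangle W M T S s v hv hvS, map_smul, map_add,
      ih (by omega) S (fun i hi => by have := hS i hi; omega), ih (by omega) (insert v S),
      Finset.range_add_one, Finset.sum_powerset_insert (by simp), ← smul_add, smul_smul, pow_succ']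
    · simp only [Finset.insert_union, Finset.union_insert]
    · intro i hi
      rcases Finset.mem_insert.mp hi with rfl | hi
      · exact le_rfl
      · have := hS i hi
        omega

theorem sum_powerset_range_indicator {n : ℕ} {E : Type*} [AddCommMonoid E]
    (f : (Fin n → Bool) → E) :
    ∑ R ∈ (Finset.range n).powerset, f (indicator n R) = ∑ x, f x := by
  refine Finset.sum_bij' (fun R _ => indicator n R)
    (fun x _ => (Finset.univ.filter fun i : Fin n => x i = true).image fun i : Fin n => (i : ℕ))
    (fun _ _ => Finset.mem_univ _) ?_ ?_ ?_ (fun _ _ => rfl)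
  · intro x _
    rw [Finset.mem_powerset]
    intro i hi
    obtain ⟨j, -, rfl⟩ := Finset.mem_image.mp hi
    simp
  · intro R hR
    rw [Finset.mem_powerset] at hR
    ext i
    simp only [indicator, decide_eq_true_eq, Finset.mem_image, Finset.mem_filter, Finset.mem_univ,
      true_and]
    constructor
    · rintro ⟨j, hj, rfl⟩
      exact hj
    · exact fun hi => ⟨⟨i, Finset.mem_range.mp (hR hi)⟩, hi, rfl⟩
  · intro x _
    funext i
    simp only [indicator, Finset.mem_image, Finset.mem_filter, Finset.mem_univ, true_and]
    by_cases h : x i = true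
    · rw [h, decide_eq_true_eq]
      exact ⟨i, h, rfl⟩
    · have : ¬ ∃ a : Fin n, x a = true ∧ (a : ℕ) = i := by
        rintro ⟨j, hj, hji⟩
        rw [Fin.ext hji] at hj
        exact h hj
      simp [this, h]

/-- The zeroth power of `V` is the identity matrix, so `V` can be chosen freely here; the
preparation makes no query, so `W` is arbitrary as well. -/
theorem runLin_prepare {n : ℕ} (W : QMatrix n) (V : QUnitary n) (M : ℕ) :
    runLin W (prepare M n) (ket ∅) =
      ((1 / Real.sqrt 2 : ℝ) : ℂ) ^ n • entangled M V 0 (counter 0) (ket ∅) := by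
  have h0 : flip (M + 2, 0) ∅ = attach M (indicator n ∅) (indicator n ∅) (counter 0) ∅ := by
    apply eq_attach
    · intro a i ha
      have : a ≠ M + 2 := by omega
      simp [mem_flip, this]
    · intro i
      simp [mem_flip, indicator]
    · intro i
      simp [mem_flip, indicator]
    · intro i
      simp [mem_flip, counter]
    · intro a i ha
      have : a ≠ M + 2 := by omega
      simp [mem_flip, this]
  rw [prepare, runLin_cons, extend_ket, Gate.onBasis, h0,
    runLin_descend_entangle W M _ _ n le_rfl ∅ (by simp)]
  simp only [Finset.union_empty]
  rw [sum_powerset_range_indicator (fun x => ket (attach M x x (counter 0) ∅)), entangled_apply]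
  simp [Matrix.one_apply, attachLin_ket]

/-! ## Expansion in powers of the phase -/

/-- The family `B`, shifted by one, plus the first `v` members of the family `C`. -/
def shiftAdd (v : ℕ) (B C : ℕ → State) (k : ℕ) : State :=
  (if k = 0 then 0 else B (k - 1)) + if k < v then C k else 0

/-- The cut-off `k < v` in `shiftAdd` matters: the longer range on the left would otherwise include
`C v`, about which nothing is assumed. -/
theorem sum_shiftAdd (v : ℕ) (B C : ℕ → State) (f : ℕ → State →ₗ[ℂ] State) :
    ∑ k ∈ Finset.range (v + 1), f k (shiftAdd v B C k) =
      ∑ k ∈ Finset.range v, f (k + 1) (B k) + ∑ k ∈ Finset.range v, f k (C k) := by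
  simp only [shiftAdd, map_add, Finset.sum_add_distrib]
  rw [Finset.sum_range_succ', Finset.sum_range_succ (fun k => f k (if k < v then C k else 0))]
  simp only [Nat.add_eq_zero_iff, one_ne_zero, and_false, if_false, Nat.add_sub_cancel, if_true,
    map_zero, add_zero, lt_irrefl]
  congr 1
  refine Finset.sum_congr rfl fun k hk => ?_
  rw [if_pos (Finset.mem_range.mp hk)]

/-- States in which all arrays from `M` on are `0`. -/
def mainStates (M : ℕ) : Submodule ℂ State :=
  Finsupp.supported ℂ ℂ {s : Finset Wire | ∀ w ∈ s, w.1 < M}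

theorem ket_mem_mainStates {M : ℕ} {s : Finset Wire} (hs : ∀ w ∈ s, w.1 < M) :
    ket s ∈ mainStates M :=
  Finsupp.single_mem_supported ℂ 1 hs

theorem extend_mem_mainStates {M : ℕ} {f : Finset Wire → State} {ψ : State}
    (hψ : ψ ∈ mainStates M) (hf : ∀ s, (∀ w ∈ s, w.1 < M) → f s ∈ mainStates M) :
    extend f ψ ∈ mainStates M := by
  rw [extend, Finsupp.linearCombination_apply, Finsupp.sum]
  refine Submodule.sum_mem _ fun s hs => Submodule.smul_mem _ _ (hf s ?_)
  exact (Finsupp.mem_supported ℂ ψ).mp hψ hs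

theorem forall_mem_flip_lt {M : ℕ} {a : Wire} (ha : a.1 < M) {s : Finset Wire}
    (hs : ∀ w ∈ s, w.1 < M) : ∀ w ∈ flip a s, w.1 < M := by
  intro w hw
  by_cases h : w = a
  · rw [h]
    exact ha
  · rw [mem_flip] at hw
    exact hs w (by tauto)

theorem applyTarget_mem_mainStates {n : ℕ} {M : ℕ} (hM : 0 < M) (V : QMatrix n) {s : Finset Wire}
    (hs : ∀ w ∈ s, w.1 < M) : applyTarget V s ∈ mainStates M := by
  refine Submodule.sum_mem _ fun y _ => Submodule.smul_mem _ _ (ket_mem_mainStates ?_)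
  rintro ⟨a, i⟩ h
  rw [mem_writeTarget] at h
  rcases h with h | h
  · exact hs _ h.1
  · rw [h.1]
    exact hM

theorem onBasis_mem_mainStates {n : ℕ} {M : ℕ} (V : QMatrix n) (g : Gate ℕ) (hg : g.ArraysLT M)
    {s : Finset Wire} (hs : ∀ w ∈ s, w.1 < M) : g.onBasis V s ∈ mainStates M := by
  have hk := ket_mem_mainStates hs
  cases g with
  | not a => exact ket_mem_mainStates (forall_mem_flip_lt hg hs)
  | cnot a b =>
    simp only [Gate.onBasis]
    split_ifs
    exacts [ket_mem_mainStates (forall_mem_flip_lt hg.2 hs), hk]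
  | toffoli a b c =>
    simp only [Gate.onBasis]
    split_ifs
    exacts [ket_mem_mainStates (forall_mem_flip_lt hg.2.2 hs), hk]
  | hadamard a =>
    refine Submodule.smul_mem _ _ (Submodule.add_mem _ (ket_mem_mainStates fun w hw => ?_)
      (Submodule.smul_mem _ _ (ket_mem_mainStates fun w hw => ?_)))
    · exact hs w (Finset.mem_of_mem_erase hw)
    · rcases Finset.mem_insert.mp hw with rfl | hw
      exacts [hg, hs w hw]
  | phase j a =>
    simp only [Gate.onBasis]
    split_ifs
    exacts [Submodule.smul_mem _ _ hk, hk]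
  | query q =>
    have hM : 0 < M := lt_trans zero_lt_one hg
    cases q with
    | uncontrolled o => exact applyTarget_mem_mainStates hM _ hs
    | controlled o =>
      simp only [Gate.onBasis]
      split_ifs
      exacts [applyTarget_mem_mainStates hM _ hs, hk]

theorem onPart_mem_mainStates {n : ℕ} {M : ℕ} (hM : 0 < M) (V : QMatrix n) {ψ : State}
    (hψ : ψ ∈ mainStates M) : onPart V ψ ∈ mainStates M := by
  refine extend_mem_mainStates hψ fun s hs => ?_
  split_ifs
  exacts [applyTarget_mem_mainStates hM _ hs, Submodule.zero_mem _]

theorem offPart_mem_mainStates {M : ℕ} {ψ : State} (hψ : ψ ∈ mainStates M) :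
    offPart ψ ∈ mainStates M := by
  refine extend_mem_mainStates hψ fun s hs => ?_
  split_ifs
  exacts [Submodule.zero_mem _, ket_mem_mainStates hs]

theorem shiftAdd_mem_mainStates {M v : ℕ} {B C : ℕ → State} (hB : ∀ k, B k ∈ mainStates M)
    (hC : ∀ k, C k ∈ mainStates M) (k : ℕ) : shiftAdd v B C k ∈ mainStates M := by
  unfold shiftAdd
  refine Submodule.add_mem _ ?_ ?_ <;> split_ifs
  exacts [Submodule.zero_mem _, hB _, hC _, Submodule.zero_mem _]

/-! ### The effect of the phase on controlled queries. -/

theorem extend_controlled {n : ℕ} (V : QMatrix n) (o : QueryOp) (ψ : State) :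
    extend ((Gate.query (.controlled o)).onBasis V) ψ = onPart (o.apply V) ψ + offPart ψ := by
  have : extend ((Gate.query (.controlled o)).onBasis V) = onPart (o.apply V) + offPart :=
    hom_ext_ket fun s => by
      by_cases hs : ((1, 0) : Wire) ∈ s <;>
        simp [onPart, offPart, extend_ket, Gate.onBasis, hs]
  rw [this, LinearMap.add_apply]

theorem onPart_smul {n : ℕ} (φ : ℂ) (V : QMatrix n) (ψ : State) :
    onPart (φ • V) ψ = φ • onPart V ψ := by
  have : onPart (φ • V) = φ • onPart V := hom_ext_ket fun s => by
    by_cases hs : ((1, 0) : Wire) ∈ s <;>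
      simp [onPart, extend_ket, hs, applyTarget, Finset.smul_sum, smul_smul]
  rw [this, LinearMap.smul_apply]

/-- On the unit circle conjugation is inversion; the two forms involving a conjugate therefore
contribute `φ⁻¹`. -/
theorem apply_smul {n : ℕ} {φ : ℂ} (hφ : ‖φ‖ = 1) (V : QMatrix n) (o : QueryOp) :
    o.apply (φ • V) = (if o.positive then φ else φ⁻¹) • o.apply V := by
  have h : star φ = φ⁻¹ := (Complex.inv_eq_conj hφ).symm
  cases o <;> simp only [QueryOp.apply, QueryOp.positive, Bool.false_eq_true, if_false, if_true]
  · rw [Matrix.conjTranspose_smul, h]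
  · ext i j
    simp only [Matrix.map_apply, Matrix.smul_apply, smul_eq_mul, star_mul', h]
  · rw [Matrix.transpose_smul]

/-- The type of a controlled query. -/
def Gate.controlledOp {ι : Type} : Gate ι → Option QueryOp
  | .query (.controlled o) => some o
  | _ => none

theorem Gate.eq_of_controlledOp_eq_some {ι : Type} {g : Gate ι} {o : QueryOp}
    (h : g.controlledOp = some o) : g = .query (.controlled o) := by
  cases g with
  | query q => cases q <;> simp_all [Gate.controlledOp]
  | _ => simp [Gate.controlledOp] at h

/-- Replace controlled queries by gadgets; the counter has values below `v` at first. -/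
def simulate (M n : ℕ) : ℕ → Circuit → Circuit
  | _, [] => []
  | v, g :: c =>
    match g.controlledOp with
    | some o => gadget M n v o ++ simulate M n (v + 1) c
    | none => g :: simulate M n v c

/-- The number of controlled queries. -/
def controlledCount (c : Circuit) : ℕ := (c.filterMap Gate.controlledOp).length

/-- All queries of an allowed circuit are controlled, so any other gate is independent of the
oracle. -/
theorem onBasis_eq_of_controlledOp_eq_none {n : ℕ} {Q : Set QueryOp} {g : Gate ℕ}
    (hg : g.Allowed (Query.controlled '' Q)) (h : g.controlledOp = none) (V W : QMatrix n) :
    g.onBasis V = g.onBasis W := by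
  cases g with
  | query q =>
    obtain ⟨o, -, rfl⟩ := hg
    simp [Gate.controlledOp] at h
  | _ => rfl

/-- The superposition of the states `A k` with phases `φ ^ (k - m)`. -/
def phaseSum (φ : ℂ) (m : ℤ) (v : ℕ) (A : ℕ → State) : State :=
  ∑ k ∈ Finset.range v, φ ^ ((k : ℤ) - m) • A k

/-- The superposition of the states `A k`, with an entangled state and a counter attached. -/
def entangledSum {n : ℕ} (M : ℕ) (V : QUnitary n) (N : ℤ) (v : ℕ) (A : ℕ → State) : State :=
  ∑ k ∈ Finset.range v, entangled M V (N - k) (counter k) (A k)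

theorem phaseSum_shiftAdd (φ : ℂ) (m : ℤ) (v : ℕ) (B C : ℕ → State) :
    phaseSum φ m (v + 1) (shiftAdd v B C) = phaseSum φ (m - 1) v B + phaseSum φ m v C := by
  have := sum_shiftAdd v B C (fun k => φ ^ ((k : ℤ) - m) • LinearMap.id)
  simp only [LinearMap.smul_apply, LinearMap.id_apply] at this
  rw [phaseSum, this, phaseSum, phaseSum]
  congr 1
  refine Finset.sum_congr rfl fun k _ => ?_
  congr 2
  push_cast
  ring

theorem entangledSum_shiftAdd {n : ℕ} (M : ℕ) (V : QUnitary n) (N : ℤ) (v : ℕ)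
    (B C : ℕ → State) :
    entangledSum M V N (v + 1) (shiftAdd v B C) =
      ∑ k ∈ Finset.range v, entangled M V (N - 1 - k) (counter (k + 1)) (B k) +
        entangledSum M V N v C := by
  rw [entangledSum, sum_shiftAdd v B C (fun k => entangled M V (N - k) (counter k)), entangledSum]
  congr 1
  refine Finset.sum_congr rfl fun k _ => ?_
  congr 2
  push_cast
  ring

theorem extend_controlled_phaseSum {n : ℕ} (V : QMatrix n) (o : QueryOp) {φ : ℂ} (hφ : ‖φ‖ = 1)
    (m : ℤ) (v : ℕ) (A : ℕ → State) :
    extend ((Gate.query (.controlled o)).onBasis (φ • V)) (phaseSum φ m v A) =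
      phaseSum φ (if o.positive then m - 1 else m + 1) v (fun k => onPart (o.apply V) (A k)) +
        phaseSum φ m v fun k => offPart (A k) := by
  have hφ0 : φ ≠ 0 := fun h => by simp [h] at hφ
  simp only [phaseSum, extend_controlled, map_sum, map_smul, apply_smul hφ, onPart_smul, smul_add,
    Finset.sum_add_distrib]
  congr 1
  refine Finset.sum_congr rfl fun k _ => ?_
  rw [smul_smul]
  congr 1
  cases o.positive
  · simp only [Bool.false_eq_true, if_false, ← sub_sub, zpow_sub_one₀ hφ0]
  · simp only [if_true, ← zpow_add_one₀ hφ0]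
    congr 1
    ring

theorem runLin_gadget_entangledSum {n : ℕ} (V : QUnitary n) {M : ℕ} (hM : 1 < M) (o : QueryOp)
    (N : ℤ) (v : ℕ) (A : ℕ → State) :
    runLin (V : QMatrix n) (gadget M n v o) (entangledSum M V N v A) =
      ∑ k ∈ Finset.range v, entangled M V (N - k)
        (if o.positive then counter (k + 1) else counter k)
          (onPart (o.apply (V : QMatrix n)) (A k)) +
      ∑ k ∈ Finset.range v, entangled M V (if o.positive then N - k + 1 else N - k - 1)
        (if o.positive then counter k else counter (k + 1)) (offPart (A k)) := by
  rw [entangledSum, map_sum, ← Finset.sum_add_distrib]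
  refine Finset.sum_congr rfl fun k hk => ?_
  rw [runLin_gadget_entangled V hM v o _ _ (fun i hi =>
    ((counter_max k).2 i hi).trans_lt (Finset.mem_range.mp hk)), counter_succ]

/-- The new coefficients are chosen before `φ`, so they are common to all phases and to the
simulation. Both families undergo the same operation: one of the two parts is shifted by one index,
the other keeps its place. -/
theorem exists_expansion_controlled {n : ℕ} (V : QUnitary n) {M : ℕ} (hM : 1 < M) (o : QueryOp)
    (v : ℕ) (m N : ℤ) (A : ℕ → State) (hA : ∀ k, A k ∈ mainStates M) :
    ∃ (m' N' : ℤ) (A' : ℕ → State), (∀ k, A' k ∈ mainStates M) ∧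
      (∀ φ : ℂ, ‖φ‖ = 1 →
        extend ((Gate.query (.controlled o)).onBasis (φ • (V : QMatrix n))) (phaseSum φ m v A) =
          phaseSum φ m' (v + 1) A') ∧
      runLin (V : QMatrix n) (gadget M n v o) (entangledSum M V N v A) =
        entangledSum M V N' (v + 1) A' := by
  have hon := fun k => onPart_mem_mainStates (by omega : 0 < M) (o.apply (V : QMatrix n)) (hA k)
  have hoff := fun k => offPart_mem_mainStates (hA k)
  cases ho : o.positive
  -- Inverse access: with `m + 1` the factor `φ⁻¹` of the on-part is absorbed at the same `k`, and
  -- the off-part moves to `k + 1`. Its exponent `N - k - 1` equals `N - (k + 1)`, so `N` stays.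
  · refine ⟨m + 1, N, _, shiftAdd_mem_mainStates (v := v) hoff hon, fun φ hφ => ?_, ?_⟩
    · rw [extend_controlled_phaseSum _ _ hφ, phaseSum_shiftAdd, add_sub_cancel_right, ho,
        if_neg Bool.false_ne_true, add_comm]
    · rw [runLin_gadget_entangledSum V hM, entangledSum_shiftAdd, ho, add_comm]
      congr 1
      refine Finset.sum_congr rfl fun k _ => ?_
      simp only [Bool.false_eq_true, if_false]
      rw [sub_right_comm]
  -- Positive access: the factor `φ` moves the on-part to `k + 1` with `m` unchanged. The off-part
  -- has exponent `N + 1 - k`, and the on-part's `N - k` equals `N + 1 - (k + 1)`.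
  · refine ⟨m, N + 1, _, shiftAdd_mem_mainStates (v := v) hon hoff, fun φ hφ => ?_, ?_⟩
    · rw [extend_controlled_phaseSum _ _ hφ, phaseSum_shiftAdd, ho, if_pos rfl]
    · rw [runLin_gadget_entangledSum V hM, entangledSum_shiftAdd, ho, entangledSum]
      simp only [if_true, add_sub_cancel_right, sub_add_eq_add_sub]

/-- A circuit on `φ • V` and its simulation on `V` have expansions with the same coefficients. -/
theorem exists_expansion {n : ℕ} (V : QUnitary n) {M : ℕ} (hM : 1 < M) {Q : Set QueryOp}
    (c : Circuit) (hc : c.Allowed (Query.controlled '' Q)) (hcM : ∀ g ∈ c, g.ArraysLT M)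
    (v : ℕ) (m N : ℤ) (A : ℕ → State) (hA : ∀ k, A k ∈ mainStates M) :
    ∃ (m' N' : ℤ) (A' : ℕ → State), (∀ k, A' k ∈ mainStates M) ∧
      (∀ φ : ℂ, ‖φ‖ = 1 → runLin (φ • (V : QMatrix n)) c (phaseSum φ m v A) =
          phaseSum φ m' (v + controlledCount c) A') ∧
      runLin (V : QMatrix n) (simulate M n v c) (entangledSum M V N v A) =
        entangledSum M V N' (v + controlledCount c) A' := by
  induction c generalizing v m N A with
  | nil => exact ⟨m, N, A, hA, fun φ _ => rfl, rfl⟩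
  | cons g c ih =>
    have hc' : Circuit.Allowed (Query.controlled '' Q) c :=
      fun g hg => hc g (List.mem_cons_of_mem _ hg)
    have hcM' : ∀ g ∈ c, g.ArraysLT M := fun g hg => hcM g (List.mem_cons_of_mem _ hg)
    have hgM := hcM g List.mem_cons_self
    cases hg : g.controlledOp with
    | none =>
      have hcount : controlledCount (g :: c) = controlledCount c := by
        simp [controlledCount, hg]
      -- A gate without oracle access acts on every coefficient separately and commutes with the
      -- attached ancillas.
      obtain ⟨m', N', A', h0, h1, h2⟩ := ih hc' hcM' v m N
        (fun k => extend (g.onBasis (V : QMatrix n)) (A k))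
        (fun k => extend_mem_mainStates (hA k) fun s hs => onBasis_mem_mainStates _ _ hgM hs)
      refine ⟨m', N', A', h0, fun φ hφ => ?_, ?_⟩
      · rw [hcount, ← h1 φ hφ, runLin_cons, phaseSum, map_sum]
        simp only [map_smul, onBasis_eq_of_controlledOp_eq_none (hc g List.mem_cons_self) hg
          (φ • (V : QMatrix n)) V]
        rfl
      · simp only [simulate, hg]
        rw [hcount, ← h2, runLin_cons, entangledSum, map_sum]
        simp only [extend_onBasis_entangled _ _ _ _ _ hgM]
        rfl
    | some o =>
      have hcount : v + controlledCount (g :: c) = v + 1 + controlledCount c := by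
        simp [controlledCount, hg]
        omega
      obtain rfl := Gate.eq_of_controlledOp_eq_some hg
      obtain ⟨m₁, N₁, A₁, hA₁, h1, h2⟩ := exists_expansion_controlled V hM o v m N A hA
      obtain ⟨m', N', A', h0, h1', h2'⟩ := ih hc' hcM' (v + 1) m₁ N₁ A₁ hA₁
      refine ⟨m', N', A', h0, fun φ hφ => ?_, ?_⟩
      · rw [hcount, ← h1' φ hφ, ← h1 φ hφ]
        rfl
      · rw [hcount, ← h2', ← h2, ← runLin_append]
        rfl

/-! ## Acceptance probabilities -/

theorem normSq_eq_sum {ψ : State} {F : Finset (Finset Wire)} (h : ψ.support ⊆ F) :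
    normSq ψ = ∑ s ∈ F, ‖ψ s‖ ^ 2 :=
  Finsupp.sum_of_support_subset _ h _ (by simp)

theorem normSq_filter_sum_ket {ι : Type*} (I : Finset ι) (a : ι → ℂ) (e : ι → Finset Wire)
    (he : Set.InjOn e I) (p : Finset Wire → Prop) [DecidablePred p] :
    normSq ((∑ i ∈ I, a i • ket (e i)).filter p) = ∑ i ∈ I, if p (e i) then ‖a i‖ ^ 2 else 0 := by
  classical
  have hcoeff : ∀ i ∈ I, (∑ j ∈ I, a j • ket (e j)) (e i) = a i := by
    intro i hi
    rw [Finsupp.finsetSum_apply, Finset.sum_eq_single i]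
    · simp [ket]
    · intro j hj hji
      have : e j ≠ e i := fun h => hji (he hj hi h)
      simp [ket, this]
    · exact fun h => absurd hi h
  have hsupp : ((∑ i ∈ I, a i • ket (e i)).filter p).support ⊆ I.image e := by
    intro s hs
    rw [Finsupp.support_filter, Finset.mem_filter, Finsupp.mem_support_iff,
      Finsupp.finsetSum_apply] at hs
    by_contra h
    refine hs.1 (Finset.sum_eq_zero fun i hi => ?_)
    have : e i ≠ s := fun h' => h (h' ▸ Finset.mem_image_of_mem e hi)
    simp [ket, this]
  rw [normSq_eq_sum hsupp, Finset.sum_image he]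
  refine Finset.sum_congr rfl fun i hi => ?_
  rw [Finsupp.filter_apply]
  split_ifs
  · rw [hcoeff i hi]
  · simp

/-! ### Orthogonality of the roots of unity and Parseval's identity. -/

theorem rootPhase_eq_pow (n : ℕ) (x : Fin (2 ^ n)) :
    rootPhase n x = Complex.exp (2 * Real.pi * Complex.I / (2 ^ n : ℕ)) ^ (x : ℕ) := by
  rw [rootPhase, ← Complex.exp_nat_mul]
  congr 1
  push_cast
  ring

theorem norm_rootPhase (n : ℕ) (x : Fin (2 ^ n)) : ‖rootPhase n x‖ = 1 := by
  have h : (2 * Real.pi * Complex.I * ((x : ℕ) : ℂ) / 2 ^ n) =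
      ((2 * Real.pi * ((x : ℕ) : ℝ) / 2 ^ n : ℝ) : ℂ) * Complex.I := by
    push_cast
    ring
  rw [rootPhase, h, Complex.norm_exp_ofReal_mul_I]

/-- For distinct exponents below `2 ^ n`, the ratio of the two powers of a primitive root is a
nontrivial `2 ^ n`-th root of unity, so the geometric sum vanishes. -/
theorem sum_rootPhase_mul_conj (n : ℕ) {k l : ℕ} (hk : k < 2 ^ n) (hl : l < 2 ^ n) :
    ∑ x : Fin (2 ^ n), rootPhase n x ^ k * star (rootPhase n x ^ l) =
      if k = l then (2 ^ n : ℂ) else 0 := by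
  split_ifs with h
  · subst h
    have : ∀ x : Fin (2 ^ n), rootPhase n x ^ k * star (rootPhase n x ^ k) = 1 := fun x => by
      rw [star_pow, ← mul_pow, rootPhase_mul_star, one_pow]
    simp only [this, Finset.sum_const, Finset.card_univ, Fintype.card_fin, nsmul_eq_mul, mul_one]
    push_cast
    rfl
  · have hq : (2 ^ n : ℕ) ≠ 0 := by positivity
    have hprim := Complex.isPrimitiveRoot_exp (2 ^ n) hq
    set ω := Complex.exp (2 * Real.pi * Complex.I / (2 ^ n : ℕ)) with hω
    have hω0 : ω ≠ 0 := Complex.exp_ne_zero _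
    have hωn : ‖ω‖ = 1 := hprim.norm'_eq_one hq
    have hstar : star ω = ω⁻¹ := (Complex.inv_eq_conj hωn).symm
    have e : ∀ x : Fin (2 ^ n), rootPhase n x ^ k * star (rootPhase n x ^ l) =
        (ω ^ k * ω⁻¹ ^ l) ^ (x : ℕ) := fun x => by
      rw [rootPhase_eq_pow, ← hω, star_pow, star_pow, hstar, mul_pow]
      simp only [← pow_mul, mul_comm]
    simp only [e]
    rw [Fin.sum_univ_eq_sum_range (fun i => (ω ^ k * ω⁻¹ ^ l) ^ i)]
    have hne : ω ^ k * ω⁻¹ ^ l ≠ 1 := by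
      intro h1
      rw [inv_pow, mul_inv_eq_one₀ (pow_ne_zero _ hω0)] at h1
      exact h (hprim.pow_inj hk hl h1)
    have hone : (ω ^ k * ω⁻¹ ^ l) ^ (2 ^ n) = 1 := by
      rw [mul_pow, ← pow_mul, ← pow_mul, mul_comm k, mul_comm l, pow_mul, pow_mul, inv_pow,
        hprim.pow_eq_one]
      simp
    have := geom_sum_mul (ω ^ k * ω⁻¹ ^ l) (2 ^ n)
    rw [hone, sub_self] at this
    exact (mul_eq_zero.mp this).resolve_right (sub_ne_zero.mpr hne)

/-- Parseval's identity for polynomials of degree less than `2 ^ n`. -/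
theorem sum_norm_sq_rootPhase (n v : ℕ) (hv : v ≤ 2 ^ n) (b : ℕ → ℂ) :
    ∑ x : Fin (2 ^ n), ‖∑ k ∈ Finset.range v, rootPhase n x ^ k * b k‖ ^ 2 =
      2 ^ n * ∑ k ∈ Finset.range v, ‖b k‖ ^ 2 := by
  have hsq : ∀ z : ℂ, ((‖z‖ ^ 2 : ℝ) : ℂ) = z * star z := fun z => by
    push_cast
    exact (Complex.mul_conj' z).symm
  have : ((∑ x : Fin (2 ^ n), ‖∑ k ∈ Finset.range v, rootPhase n x ^ k * b k‖ ^ 2 : ℝ) : ℂ) =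
      ((2 ^ n * ∑ k ∈ Finset.range v, ‖b k‖ ^ 2 : ℝ) : ℂ) := by
    rw [Complex.ofReal_sum, Complex.ofReal_mul, Complex.ofReal_sum]
    simp only [hsq, star_sum, Finset.sum_mul_sum]
    rw [Finset.sum_comm, Finset.mul_sum]
    refine Finset.sum_congr rfl fun k hk => ?_
    rw [Finset.sum_comm, Finset.sum_eq_single k]
    · have := sum_rootPhase_mul_conj n (k := k) (l := k)
        ((Finset.mem_range.mp hk).trans_le hv) ((Finset.mem_range.mp hk).trans_le hv)
      rw [if_pos rfl] at this
      push_cast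
      rw [← this, Finset.sum_mul]
      refine Finset.sum_congr rfl fun x _ => ?_
      rw [star_mul']
      ring
    · intro l hl hlk
      have := sum_rootPhase_mul_conj n (k := k) (l := l)
        ((Finset.mem_range.mp hk).trans_le hv) ((Finset.mem_range.mp hl).trans_le hv)
      rw [if_neg (Ne.symm hlk)] at this
      rw [← zero_mul (b k * star (b l)), ← this, Finset.sum_mul]
      refine Finset.sum_congr rfl fun x _ => ?_
      rw [star_mul']
      ring
    · exact fun h => absurd hk h
  exact_mod_cast this

theorem sum_norm_sq_unitary {n : ℕ} (V : QUnitary n) :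
    ∑ y, ∑ x, ‖(V : QMatrix n) y x‖ ^ 2 = 2 ^ n := by
  have hrow : ∀ y, ∑ x, ‖(V : QMatrix n) y x‖ ^ 2 = 1 := by
    intro y
    have h := congrFun (congrFun (Matrix.mem_unitaryGroup_iff.mp V.2) y) y
    rw [Matrix.mul_apply, Matrix.one_apply_eq] at h
    have : ((∑ x, ‖(V : QMatrix n) y x‖ ^ 2 : ℝ) : ℂ) = ((1 : ℝ) : ℂ) := by
      rw [Complex.ofReal_one, ← h, Complex.ofReal_sum]
      refine Finset.sum_congr rfl fun x _ => ?_
      rw [Matrix.star_apply]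
      push_cast
      exact (Complex.mul_conj' _).symm
    exact_mod_cast this
  simp [hrow]

theorem eq_sum_ket {ψ : State} {F : Finset (Finset Wire)} (h : ψ.support ⊆ F) :
    ψ = ∑ s ∈ F, ψ s • ket s := by
  conv_lhs => rw [← Finsupp.sum_single ψ]
  rw [Finsupp.sum_of_support_subset _ h _ (by simp)]
  simp [ket]

/-- `attach` discards everything in `s` from array `M` on, hence the restriction on `s` and `s'`.
This is the purpose of tracking `mainStates`. -/
theorem attach_injective {n : ℕ} {M : ℕ} {y y' x x' : Fin n → Bool} {T T' : Finset ℕ}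
    {s s' : Finset Wire} (hs : ∀ w ∈ s, w.1 < M) (hs' : ∀ w ∈ s', w.1 < M)
    (h : attach M y x T s = attach M y' x' T' s') : T = T' ∧ y = y' ∧ x = x' ∧ s = s' := by
  have hmem : ∀ a i, (a, i) ∈ attach M y x T s ↔ (a, i) ∈ attach M y' x' T' s' := by simp [h]
  refine ⟨?_, ?_, ?_, ?_⟩
  · ext i
    simpa [mem_attach] using hmem (M + 2) i
  · funext i
    have := hmem M i
    simp only [mem_attach, lt_irrefl, false_and, true_and, false_or, Nat.left_eq_add, one_ne_zero,
      OfNat.ofNat_ne_zero, or_false, Fin.is_lt, Fin.eta, exists_true_left] at this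
    exact Bool.eq_iff_iff.mpr this
  · funext i
    have := hmem (M + 1) i
    simpa [mem_attach, ← Bool.eq_iff_iff] using this
  · ext w
    by_cases hw : w.1 < M
    · rw [← mem_attach_of_lt y x T s hw, h, mem_attach_of_lt _ _ _ _ hw]
    · exact ⟨fun h => absurd (hs w h) hw, fun h => absurd (hs' w h) hw⟩

/-- For each basis state the amplitude is a polynomial in `φ`, up to a power of `φ`; Parseval
applies to each amplitude. -/
theorem sum_normSq_filter_phaseSum (n v : ℕ) (hv : v ≤ 2 ^ n) (m : ℤ) (A : ℕ → State)
    (F : Finset (Finset Wire)) (hF : ∀ k, k < v → (A k).support ⊆ F) (p : Finset Wire → Prop)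
    [DecidablePred p] :
    ∑ x : Fin (2 ^ n), normSq ((phaseSum (rootPhase n x) m v A).filter p) =
      2 ^ n * ∑ k ∈ Finset.range v, ∑ s ∈ F, if p s then ‖A k s‖ ^ 2 else 0 := by
  have h1 : ∀ φ, phaseSum φ m v A =
      ∑ s ∈ F, (∑ k ∈ Finset.range v, φ ^ ((k : ℤ) - m) * A k s) • ket s := by
    intro φ
    simp only [phaseSum, Finset.sum_smul]
    rw [Finset.sum_comm]
    refine Finset.sum_congr rfl fun k hk => ?_
    conv_lhs => rw [eq_sum_ket (hF k (Finset.mem_range.mp hk)), Finset.smul_sum]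
    simp only [smul_smul]
  -- The common factor `φ ^ (-m)` has modulus one, so negative exponents play no role.
  have h2 : ∀ (x : Fin (2 ^ n)) (s : Finset Wire),
      ‖∑ k ∈ Finset.range v, rootPhase n x ^ ((k : ℤ) - m) * A k s‖ =
        ‖∑ k ∈ Finset.range v, rootPhase n x ^ k * A k s‖ := by
    intro x s
    have h0 : rootPhase n x ≠ 0 := fun h => by simpa [h] using norm_rootPhase n x
    have : ∑ k ∈ Finset.range v, rootPhase n x ^ ((k : ℤ) - m) * A k s =
        rootPhase n x ^ (-m) * ∑ k ∈ Finset.range v, rootPhase n x ^ k * A k s := by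
      rw [Finset.mul_sum]
      refine Finset.sum_congr rfl fun k _ => ?_
      rw [sub_eq_neg_add, zpow_add₀ h0, zpow_natCast, mul_assoc]
    rw [this, norm_mul, norm_zpow, norm_rootPhase, one_zpow, one_mul]
  simp only [h1]
  simp only [normSq_filter_sum_ket F _ (fun s => s) (fun _ _ _ _ h => h) p, h2]
  rw [Finset.sum_comm, Finset.sum_comm (s := Finset.range v), Finset.mul_sum]
  refine Finset.sum_congr rfl fun s _ => ?_
  split_ifs
  · exact sum_norm_sq_rootPhase n v hv _
  · simp

/-- Different values of the counter make the terms orthogonal, so nothing interferes across `k`.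
Every power of `V` is unitary and has squared Frobenius norm `2 ^ n`, so the ancilla contributes the
same factor for each `k`. -/
theorem normSq_filter_entangledSum {n M : ℕ} (V : QUnitary n) (N : ℤ) (v : ℕ) (A : ℕ → State)
    (r : ℂ) (F : Finset (Finset Wire)) (hF : ∀ k, k < v → (A k).support ⊆ F)
    (hFM : ∀ s ∈ F, ∀ w ∈ s, w.1 < M) (p : Finset Wire → Prop) [DecidablePred p]
    (hp : ∀ (y x : Fin n → Bool) T s, p (attach M y x T s) ↔ p s) :
    normSq ((r • entangledSum M V N v A).filter p) =
      ‖r‖ ^ 2 * 2 ^ n * ∑ k ∈ Finset.range v, ∑ s ∈ F, if p s then ‖A k s‖ ^ 2 else 0 := by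
  have h1 : r • entangledSum M V N v A =
      ∑ i ∈ Finset.range v ×ˢ (Finset.univ : Finset (Fin n → Bool)) ×ˢ
          (Finset.univ : Finset (Fin n → Bool)) ×ˢ F,
        (r * ((V ^ (N - i.1) : QUnitary n) : QMatrix n) i.2.1 i.2.2.1 * A i.1 i.2.2.2) •
          ket (attach M i.2.1 i.2.2.1 (counter i.1) i.2.2.2) := by
    simp only [Finset.sum_product, entangledSum, entangled_apply, Finset.smul_sum]
    refine Finset.sum_congr rfl fun k hk => Finset.sum_congr rfl fun y _ =>
      Finset.sum_congr rfl fun x _ => ?_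
    conv_lhs => rw [eq_sum_ket (hF k (Finset.mem_range.mp hk))]
    simp only [map_sum, map_smul, attachLin_ket, Finset.smul_sum, smul_smul, mul_assoc]
  rw [h1, normSq_filter_sum_ket]
  · simp only [Finset.sum_product, hp, norm_mul, mul_pow]
    rw [Finset.mul_sum]
    refine Finset.sum_congr rfl fun k _ => ?_
    have h2 : ∀ a b : ℝ, (∑ s ∈ F, if p s then a * b * ‖A k s‖ ^ 2 else 0) =
        b * (a * ∑ s ∈ F, if p s then ‖A k s‖ ^ 2 else 0) := fun a b => by
      rw [← mul_assoc, mul_comm b, Finset.mul_sum]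
      exact Finset.sum_congr rfl fun s _ => by split_ifs <;> simp
    simp only [h2, ← Finset.sum_mul, sum_norm_sq_unitary]
    ring
  · rintro ⟨k, y, x, s⟩ hi ⟨k', y', x', s'⟩ hi' h
    simp only [Finset.coe_product, Set.mem_prod, Finset.mem_coe] at hi hi'
    obtain ⟨hT, rfl, rfl, rfl⟩ := attach_injective (hFM s hi.2.2.2) (hFM s' hi'.2.2.2) h
    obtain rfl : k = k' := counter_injective hT
    rfl

/-- The probability that a circuit with controlled queries accepts on `φ • V`, for a random root of
unity `φ`, is the probability that its simulation without controlled queries accepts on `V`. -/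
theorem sum_acceptProb_phase {n : ℕ} (V : QUnitary n) {M : ℕ} (hM : 2 < M) {Q : Set QueryOp}
    (c : Circuit) (hc : c.Allowed (Query.controlled '' Q)) (hcM : ∀ g ∈ c, g.ArraysLT M)
    (hcount : controlledCount c < 2 ^ n) :
    ∑ x : Fin (2 ^ n), acceptProb (phaseMul x V : QMatrix n) c =
      2 ^ n * acceptProb (V : QMatrix n) (prepare M n ++ simulate M n 1 c) := by
  classical
  obtain ⟨m', N', A, hA, h1, h2⟩ := exists_expansion V (by omega : 1 < M) c hc hcM 1 0 0
    (fun _ => ket ∅) (fun _ => ket_mem_mainStates (by simp))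
  set v := 1 + controlledCount c with hv
  have hp0 : ∀ φ : ℂ, phaseSum φ 0 1 (fun _ => ket ∅) = ket ∅ := fun φ => by simp [phaseSum]
  have he0 : entangledSum M V 0 1 (fun _ => ket ∅) = entangled M V 0 (counter 0) (ket ∅) := by
    simp [entangledSum]
  set F := (Finset.range v).biUnion fun k => (A k).support with hFdef
  have hF : ∀ k, k < v → (A k).support ⊆ F := fun k hk =>
    Finset.subset_biUnion_of_mem (fun k => (A k).support) (Finset.mem_range.mpr hk)
  have hFM : ∀ s ∈ F, ∀ w ∈ s, w.1 < M := by
    intro s hs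
    obtain ⟨k, -, hk⟩ := Finset.mem_biUnion.mp hs
    exact (Finsupp.mem_supported ℂ _).mp (hA k) hk
  have hl : ∀ x : Fin (2 ^ n), acceptProb (phaseMul x V : QMatrix n) c =
      normSq ((phaseSum (rootPhase n x) m' v A).filter fun s => ((2, 0) : Wire) ∈ s) := fun x => by
    rw [acceptProb, runCircuit_eq_runLin, ← h1 _ (norm_rootPhase n x), hp0]
    rfl
  -- The normalisation from the `n` Hadamard gates cancels the squared Frobenius norm of the
  -- ancilla.
  have hr : ‖((1 / Real.sqrt 2 : ℝ) : ℂ) ^ n‖ ^ 2 * 2 ^ n = 1 := by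
    rw [norm_pow, Complex.norm_real, Real.norm_of_nonneg (by positivity), ← pow_mul, mul_comm n,
      pow_mul, div_pow, Real.sq_sqrt (by norm_num), one_pow, ← mul_pow]
    norm_num
  simp only [hl]
  rw [sum_normSq_filter_phaseSum n v (by omega) m' A F hF, acceptProb, runCircuit_eq_runLin,
    runLin_append, runLin_prepare _ V, map_smul, ← he0, h2,
    normSq_filter_entangledSum V N' v A _ F hF hFM, hr, one_mul]
  intro y x T s
  exact mem_attach_of_lt _ _ _ _ hM

/-! ## Continuity of the acceptance probability -/

/-- A state that depends continuously on a parameter, with support in a fixed finite set. -/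
def ContinuousState {X : Type*} [TopologicalSpace X] (Ψ : X → State) : Prop :=
  ∃ (F : Finset (Finset Wire)) (a : Finset Wire → X → ℂ), (∀ s, Continuous (a s)) ∧
    ∀ V, Ψ V = ∑ s ∈ F, a s V • ket s

namespace ContinuousState

variable {X : Type*} [TopologicalSpace X]

theorem smul {Ψ : X → State} (h : ContinuousState Ψ) {f : X → ℂ} (hf : Continuous f) :
    ContinuousState fun V => f V • Ψ V := by
  obtain ⟨F, a, ha, h⟩ := h
  refine ⟨F, fun s V => f V * a s V, fun s => hf.mul (ha s), fun V => ?_⟩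
  simp only [h, Finset.smul_sum, smul_smul]

theorem const (ψ : State) : ContinuousState fun _ : X => ψ :=
  ⟨ψ.support, fun s _ => ψ s, fun _ => continuous_const, fun _ => eq_sum_ket subset_rfl⟩

theorem add {Ψ Φ : X → State} (h : ContinuousState Ψ) (h' : ContinuousState Φ) :
    ContinuousState fun V => Ψ V + Φ V := by
  classical
  obtain ⟨F, a, ha, h⟩ := h
  obtain ⟨G, b, hb, h'⟩ := h'
  refine ⟨F ∪ G, fun s V => (if s ∈ F then a s V else 0) + if s ∈ G then b s V else 0,
    fun s => ?_, fun V => ?_⟩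
  · by_cases h1 : s ∈ F <;> by_cases h2 : s ∈ G <;> simp only [h1, h2, if_true, if_false] <;>
      fun_prop
  · simp only [h, h', add_smul, Finset.sum_add_distrib, ite_smul, zero_smul, Finset.sum_ite_mem,
      Finset.union_inter_cancel_left, Finset.union_inter_cancel_right]

theorem sum {ι : Type*} (I : Finset ι) {Ψ : ι → X → State} (h : ∀ i ∈ I, ContinuousState (Ψ i)) :
    ContinuousState fun V => ∑ i ∈ I, Ψ i V := by
  classical
  induction I using Finset.induction_on with
  | empty => exact const 0
  | insert i I hi ih =>
    simp only [Finset.sum_insert hi]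
    exact (h i (Finset.mem_insert_self i I)).add
      (ih fun j hj => h j (Finset.mem_insert_of_mem hj))

theorem extend {Ψ : X → State} (h : ContinuousState Ψ) {f : X → Finset Wire → State}
    (hf : ∀ s, ContinuousState fun V => f V s) : ContinuousState fun V => extend (f V) (Ψ V) := by
  obtain ⟨F, a, ha, h⟩ := h
  simp only [h, map_sum, map_smul, extend_ket]
  exact sum F fun s _ => (hf s).smul (ha s)

theorem continuous_normSq_filter {Ψ : X → State} (h : ContinuousState Ψ) (p : Finset Wire → Prop)
    [DecidablePred p] : Continuous fun V => normSq ((Ψ V).filter p) := by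
  obtain ⟨F, a, ha, h⟩ := h
  simp only [h, normSq_filter_sum_ket F _ (fun s => s) (fun _ _ _ _ h => h) p]
  refine continuous_finsetSum _ fun s _ => ?_
  split_ifs
  · exact (ha s).norm.pow 2
  · exact continuous_const

end ContinuousState

theorem continuousState_applyTarget {n : ℕ} (o : QueryOp) (s : Finset Wire) :
    ContinuousState fun V : QUnitary n => applyTarget (o.apply (V : QMatrix n)) s := by
  have hV : ∀ y x, Continuous fun V : QUnitary n => (V : QMatrix n) y x := fun y x =>
    (continuous_apply_apply y x).comp continuous_subtype_val
  refine ContinuousState.sum _ fun y _ => (ContinuousState.const _).smul ?_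
  cases o
  exacts [hV _ _, (hV _ _).star, (hV _ _).star, hV _ _]

theorem continuousState_onBasis {n : ℕ} (g : Gate ℕ) (s : Finset Wire) :
    ContinuousState fun V : QUnitary n => g.onBasis (V : QMatrix n) s := by
  cases g with
  | query q =>
    cases q with
    | uncontrolled o => exact continuousState_applyTarget o s
    | controlled o =>
      simp only [Gate.onBasis]
      split_ifs
      exacts [continuousState_applyTarget o s, ContinuousState.const _]
  | _ => exact ContinuousState.const _

/-- A fixed circuit reaches only finitely many basis states from a fixed finite support, so
continuity can be checked on coefficients. It is needed for integrability against Haar measure. -/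
theorem continuousState_runLin {n : ℕ} (c : Circuit) {Ψ : QUnitary n → State}
    (hΨ : ContinuousState Ψ) :
    ContinuousState fun V : QUnitary n => runLin (V : QMatrix n) c (Ψ V) := by
  induction c generalizing Ψ with
  | nil => exact hΨ
  | cons g c ih => exact ih (hΨ.extend (continuousState_onBasis g))

theorem continuous_acceptProb {n : ℕ} (c : Circuit) :
    Continuous fun V : QUnitary n => acceptProb (V : QMatrix n) c := by
  simp only [acceptProb, runCircuit_eq_runLin]
  exact (continuousState_runLin c (ContinuousState.const _)).continuous_normSq_filter _

/-! ### Averaging over Haar measure and over keys. -/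

instance isProbabilityMeasure_haar (n : ℕ) : IsProbabilityMeasure (haar n) := by
  constructor
  have := Measure.haarMeasure_self (K₀ := (⊤ : TopologicalSpace.PositiveCompacts (QUnitary n)))
  simpa [haar] using this

/-- Multiplication by `φ` is left translation by the scalar unitary `φ • 1`, and Haar measure is
left invariant. -/
theorem integral_acceptProb_phaseMul {n : ℕ} (c : Circuit) (x : Fin (2 ^ n)) :
    ∫ V : QUnitary n, acceptProb (phaseMul x V : QMatrix n) c ∂(haar n) = haarAcceptProb n c := by
  have : (haar n).IsMulLeftInvariant := by
    unfold haar
    infer_instance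
  have h : ∀ V : QUnitary n, phaseMul x V = phaseMul x 1 * V := fun V => by
    apply Subtype.ext
    simp [phaseMul]
  refine Eq.trans (integral_congr_ae (ae_of_all _ fun V => ?_))
    (integral_mul_left_eq_self (fun V : QUnitary n => acceptProb (V : QMatrix n) c) (phaseMul x 1))
  exact congrArg (fun W : QUnitary n => acceptProb (W : QMatrix n) c) (h V)

theorem integrable_acceptProb_phaseMul {n : ℕ} (c : Circuit) (x : Fin (2 ^ n)) :
    Integrable (fun V : QUnitary n => acceptProb (phaseMul x V : QMatrix n) c) (haar n) := by
  have h : Continuous fun V : QUnitary n => phaseMul x V :=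
    (continuous_subtype_val.const_smul (rootPhase n x)).subtype_mk _
  exact ((continuous_acceptProb c).comp h).integrable_of_hasCompactSupport
    (HasCompactSupport.of_compactSpace _)

/-- Integrating `sum_acceptProb_phase` gives `2 ^ n` equal integrals on one side, because the phase
is absorbed by Haar measure. -/
theorem haarAcceptProb_simulate {n : ℕ} {M : ℕ} (hM : 2 < M) {Q : Set QueryOp}
    (c : Circuit) (hc : c.Allowed (Query.controlled '' Q)) (hcM : ∀ g ∈ c, g.ArraysLT M)
    (hcount : controlledCount c < 2 ^ n) :
    haarAcceptProb n (prepare M n ++ simulate M n 1 c) = haarAcceptProb n c := by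
  have h2 : (2 ^ n : ℝ) ≠ 0 := by positivity
  refine mul_left_cancel₀ h2 ?_
  rw [haarAcceptProb, ← integral_const_mul]
  simp only [← sum_acceptProb_phase _ hM c hc hcM hcount]
  rw [integral_finsetSum _ fun x _ => integrable_acceptProb_phaseMul c x]
  simp [integral_acceptProb_phaseMul]

theorem keyAcceptProb_withPhase (𝒰 : UnitaryFamily) {n : ℕ} {M : ℕ} (hM : 2 < M) {Q : Set QueryOp}
    (c : Circuit) (hc : c.Allowed (Query.controlled '' Q)) (hcM : ∀ g ∈ c, g.ArraysLT M)
    (hcount : controlledCount c < 2 ^ n) :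
    𝒰.withPhase.keyAcceptProb n c =
      𝒰.keyAcceptProb n (prepare M n ++ simulate M n 1 c) := by
  have h2 : (2 ^ n : ℝ) ≠ 0 := by positivity
  have hsum : ∑ k : 𝒰.withPhase.Key n, acceptProb (𝒰.withPhase.unitary n k : QMatrix n) c =
      2 ^ n * ∑ k : 𝒰.Key n, acceptProb (𝒰.unitary n k : QMatrix n)
        (prepare M n ++ simulate M n 1 c) := by
    refine (Fintype.sum_prod_type (α₁ := 𝒰.Key n) (α₂ := Fin (2 ^ n)) fun kx =>
      acceptProb (phaseMul kx.2 (𝒰.unitary n kx.1) : QMatrix n) c).trans ?_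
    simp only [sum_acceptProb_phase _ hM c hc hcM hcount, Finset.mul_sum]
  have hcard : (Fintype.card (𝒰.withPhase.Key n) : ℝ) = 2 ^ n * Fintype.card (𝒰.Key n) := by
    have : Fintype.card (𝒰.withPhase.Key n) = Fintype.card (𝒰.Key n) * Fintype.card (Fin (2 ^ n)) :=
      Fintype.card_prod _ _
    rw [this]
    push_cast
    simp [mul_comm]
  rw [UnitaryFamily.keyAcceptProb, UnitaryFamily.keyAcceptProb, hsum, hcard,
    mul_div_mul_left _ _ h2]

/-! ## Programs with bounded running time -/

/-- `Exec` with a bound on the number of steps. -/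
def ExecLE (P : Prog) (s : Store) (c : Circuit) (B : ℕ) (s' : Store) : Prop :=
  ∃ t ≤ B, Exec P s c t s'

theorem Exec.execLE {P : Prog} {s s' : Store} {c : Circuit} {t : ℕ} (h : Exec P s c t s') :
    ExecLE P s c t s' := ⟨t, le_rfl, h⟩

namespace ExecLE

theorem mono {P : Prog} {s s' : Store} {c : Circuit} {B B' : ℕ} (h : ExecLE P s c B s')
    (hB : B ≤ B') : ExecLE P s c B' s' := by
  obtain ⟨t, ht, h⟩ := h
  exact ⟨t, ht.trans hB, h⟩

theorem seq {P P' : Prog} {s s₁ s₂ : Store} {c c' : Circuit} {B B' : ℕ} (h : ExecLE P s c B s₁)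
    (h' : ExecLE P' s₁ c' B' s₂) : ExecLE (.seq P P') s (c ++ c') (B + B') s₂ := by
  obtain ⟨t, ht, h⟩ := h
  obtain ⟨t', ht', h'⟩ := h'
  exact ⟨t + t', add_le_add ht ht', .seq h h'⟩

theorem seq_nil {P P' : Prog} {s s₁ s₂ : Store} {c' : Circuit} {B B' : ℕ}
    (h : ExecLE P s [] B s₁) (h' : ExecLE P' s₁ c' B' s₂) :
    ExecLE (.seq P P') s c' (B + B') s₂ := h.seq h'

theorem loopStep {r : ℕ} {P : Prog} {s s₁ s₂ : Store} {c c' : Circuit} {B B' : ℕ} (hs : s r ≠ [])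
    (h : ExecLE P s c B s₁) (h' : ExecLE (.loop r P) s₁ c' B' s₂) :
    ExecLE (.loop r P) s (c ++ c') (B + B' + 1) s₂ := by
  obtain ⟨t, ht, h⟩ := h
  obtain ⟨t', ht', h'⟩ := h'
  exact ⟨t + t' + 1, by omega, .loopStep hs h h'⟩

end ExecLE

/-- The registers below `M` are as in `s`; register `M + a` has height `h a`. -/
def mix (M : ℕ) (s : Store) (h : ℕ → ℕ) : Store :=
  fun r => if r < M then s r else List.replicate (h (r - M)) true

theorem mix_of_lt {M : ℕ} (s : Store) (h : ℕ → ℕ) {r : ℕ} (hr : r < M) : mix M s h r = s r :=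
  if_pos hr

theorem mix_add (M : ℕ) (s : Store) (h : ℕ → ℕ) (a : ℕ) :
    mix M s h (M + a) = List.replicate (h a) true := by
  simp [mix]

theorem length_mix_add (M : ℕ) (s : Store) (h : ℕ → ℕ) (a : ℕ) :
    (mix M s h (M + a)).length = h a := by
  simp [mix_add]

theorem update_mix_of_lt {M : ℕ} (s : Store) (h : ℕ → ℕ) {r : ℕ} (hr : r < M) (l : List Bool) :
    Function.update (mix M s h) r l = mix M (Function.update s r l) h := by
  funext i
  by_cases hi : i = r
  · subst hi
    simp [mix, hr]
  · simp [mix, hi]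

theorem update_mix_add (M : ℕ) (s : Store) (h : ℕ → ℕ) (a v : ℕ) :
    Function.update (mix M s h) (M + a) (List.replicate v true) =
      mix M s (Function.update h a v) := by
  funext i
  by_cases hi : i = M + a
  · subst hi
    simp [mix]
  · by_cases hiM : i < M
    · simp [mix, hi, hiM]
    · have : i - M ≠ a := by omega
      simp [mix, hi, hiM, this]

theorem execLE_push (M : ℕ) (s : Store) (h : ℕ → ℕ) (a : ℕ) :
    ExecLE (.push (M + a) true) (mix M s h) [] 1 (mix M s (Function.update h a (h a + 1))) := by
  have := Exec.push (M + a) true (mix M s h)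
  rw [mix_add, ← List.replicate_succ, update_mix_add] at this
  exact this.execLE

theorem execLE_pop (M : ℕ) (s : Store) (h : ℕ → ℕ) (a : ℕ) :
    ExecLE (.pop (M + a)) (mix M s h) [] 1 (mix M s (Function.update h a (h a - 1))) := by
  have := Exec.pop (M + a) (mix M s h)
  rw [mix_add, List.tail_replicate, update_mix_add] at this
  exact this.execLE

theorem execLE_loop_zero (M : ℕ) (s : Store) {h : ℕ → ℕ} {a : ℕ} (ha : h a = 0) (P : Prog) :
    ExecLE (.loop (M + a) P) (mix M s h) [] 1 (mix M s h) :=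
  (Exec.loopDone (by rw [mix_add, ha]; rfl)).execLE

theorem mix_add_ne_nil (M : ℕ) (s : Store) {h : ℕ → ℕ} {a : ℕ} (ha : h a ≠ 0) :
    mix M s h (M + a) ≠ [] := by
  rw [mix_add]
  simpa using ha

/-- The total cost of a circuit. -/
def totalCost (c : Circuit) : ℕ := (c.map Gate.cost).sum

/-- Apply a list of gates. -/
def emitAll : List (Gate ℕ) → Prog
  | [] => .skip
  | g :: gs => .seq (.emit g) (emitAll gs)

theorem execLE_emitAll (gs : List (Gate ℕ)) (s : Store) :
    ExecLE (emitAll gs) s (gs.map (Gate.map fun r => (s r).length))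
      (totalCost (gs.map (Gate.map fun r => (s r).length)) + 1) s := by
  induction gs with
  | nil => exact (Exec.skip s).execLE
  | cons g gs ih =>
    refine (((Exec.emit g s).execLE).seq ih).mono (le_of_eq ?_)
    simp [totalCost, add_assoc]

/-! ## Loops over positions -/

/-- Run `P` while the register `a` counts down; `b` counts down with it, and `i` counts up. At the
end, all registers are restored. -/
def countdown (M a b i : ℕ) (P : Prog) : Prog :=
  .seq
    (.loop (M + a) (.seq (.pop (M + a)) (.seq (.pop (M + b)) (.seq P (.push (M + i) true)))))
    (.loop (M + i) (.seq (.pop (M + i)) (.seq (.push (M + a) true) (.push (M + b) true))))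

/-- The heights `h`, except for `v` in `a`, `w` in `b` and `k` in `i`. -/
def setHeights (h : ℕ → ℕ) (a b i v w k : ℕ) : ℕ → ℕ :=
  fun j => if j = a then v else if j = b then w else if j = i then k else h j

/-- Register `b` stays `e` above `a`, so the body can address the positions `u` and `u + e`.
Register `i` counts the passes for the later restoration; the body has to work for every content `k`
of it. -/
theorem execLE_countdown_down (M : ℕ) {a b i : ℕ} (hab : a ≠ b) (hai : a ≠ i) (hbi : b ≠ i)
    (P : Prog) (s : Store) (h : ℕ → ℕ) (e B : ℕ) (f : ℕ → Circuit) (v k : ℕ)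
    (hP : ∀ u < v, ∀ k, ExecLE P (mix M s (setHeights h a b i u (u + e) k)) (f u) B
      (mix M s (setHeights h a b i u (u + e) k))) :
    ExecLE (.loop (M + a) (.seq (.pop (M + a)) (.seq (.pop (M + b)) (.seq P (.push (M + i) true)))))
      (mix M s (setHeights h a b i v (v + e) k)) (descend f v) (v * (B + 4) + 1)
      (mix M s (setHeights h a b i 0 e (k + v))) := by
  induction v generalizing k with
  | zero =>
    simp only [Nat.zero_mul, zero_add, add_zero]
    exact execLE_loop_zero M s (by simp [setHeights]) _
  | succ v ih =>
    have h1 := execLE_pop M s (setHeights h a b i (v + 1) (v + 1 + e) k) a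
    have e1 : Function.update (setHeights h a b i (v + 1) (v + 1 + e) k) a
        (setHeights h a b i (v + 1) (v + 1 + e) k a - 1) =
        setHeights h a b i v (v + 1 + e) k := by
      funext j
      simp only [Function.update_apply, setHeights, if_true]
      split_ifs <;> rfl
    rw [e1] at h1
    have h2 := execLE_pop M s (setHeights h a b i v (v + 1 + e) k) b
    have e2 : Function.update (setHeights h a b i v (v + 1 + e) k) b
        (setHeights h a b i v (v + 1 + e) k b - 1) = setHeights h a b i v (v + e) k := by
      funext j
      simp only [Function.update_apply, setHeights, if_true]
      split_ifs <;> first | rfl | omega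
    rw [e2] at h2
    have h3 := execLE_push M s (setHeights h a b i v (v + e) k) i
    have e3 : Function.update (setHeights h a b i v (v + e) k) i
        (setHeights h a b i v (v + e) k i + 1) = setHeights h a b i v (v + e) (k + 1) := by
      funext j
      simp only [Function.update_apply, setHeights, if_true]
      split_ifs <;> first | rfl | omega
    rw [e3] at h3
    have h4 := ih (k + 1) fun u hu => hP u (by omega)
    rw [add_assoc, add_comm 1 v] at h4
    have h5 := (h1.seq_nil (h2.seq_nil ((hP v (by omega) k).seq h3)))
    rw [List.append_nil] at h5
    refine (ExecLE.loopStep (mix_add_ne_nil M s (by simp [setHeights])) h5 h4).mono (le_of_eq ?_)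
    ring

theorem execLE_countdown_up (M : ℕ) {a b i : ℕ} (hab : a ≠ b) (hai : a ≠ i) (hbi : b ≠ i)
    (s : Store) (h : ℕ → ℕ) (e v k : ℕ) :
    ExecLE (.loop (M + i) (.seq (.pop (M + i)) (.seq (.push (M + a) true) (.push (M + b) true))))
      (mix M s (setHeights h a b i v (v + e) k)) [] (k * 4 + 1)
      (mix M s (setHeights h a b i (v + k) (v + k + e) 0)) := by
  induction k generalizing v with
  | zero =>
    simp only [Nat.zero_mul, zero_add, add_zero]
    exact execLE_loop_zero M s (by simp [setHeights, hai.symm, hbi.symm]) _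
  | succ k ih =>
    have h1 := execLE_pop M s (setHeights h a b i v (v + e) (k + 1)) i
    have e1 : Function.update (setHeights h a b i v (v + e) (k + 1)) i
        (setHeights h a b i v (v + e) (k + 1) i - 1) = setHeights h a b i v (v + e) k := by
      funext j
      simp only [Function.update_apply, setHeights, if_true]
      split_ifs <;> first | rfl | omega
    rw [e1] at h1
    have h2 := execLE_push M s (setHeights h a b i v (v + e) k) a
    have e2 : Function.update (setHeights h a b i v (v + e) k) a
        (setHeights h a b i v (v + e) k a + 1) = setHeights h a b i (v + 1) (v + e) k := by
      funext j
      simp only [Function.update_apply, setHeights, if_true]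
      split_ifs <;> rfl
    rw [e2] at h2
    have h3 := execLE_push M s (setHeights h a b i (v + 1) (v + e) k) b
    have e3 : Function.update (setHeights h a b i (v + 1) (v + e) k) b
        (setHeights h a b i (v + 1) (v + e) k b + 1) =
        setHeights h a b i (v + 1) (v + 1 + e) k := by
      funext j
      simp only [Function.update_apply, setHeights, if_true]
      split_ifs <;> first | rfl | omega
    rw [e3] at h3
    have h4 := ih (v + 1)
    rw [add_assoc v 1 k, add_comm 1 k] at h4
    refine (ExecLE.loopStep (c := []) (mix_add_ne_nil M s (by simp [setHeights, hai.symm, hbi.symm]))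
      (h1.seq_nil (h2.seq_nil h3)) h4).mono (le_of_eq ?_)
    ring

theorem execLE_countdown (M : ℕ) {a b i : ℕ} (hab : a ≠ b) (hai : a ≠ i) (hbi : b ≠ i)
    (P : Prog) (s : Store) (h : ℕ → ℕ) (e B : ℕ) (f : ℕ → Circuit) (v : ℕ)
    (hP : ∀ u < v, ∀ k, ExecLE P (mix M s (setHeights h a b i u (u + e) k)) (f u) B
      (mix M s (setHeights h a b i u (u + e) k)))
    (ha : h a = v) (hb : h b = v + e) (hi : h i = 0) :
    ExecLE (countdown M a b i P) (mix M s h) (descend f v) (v * (B + 8) + 2) (mix M s h) := by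
  have h1 := execLE_countdown_down M hab hai hbi P s h e B f v 0 hP
  have h2 := execLE_countdown_up M hab hai hbi s h e 0 (0 + v)
  have e0 : setHeights h a b i v (v + e) 0 = h := by
    funext j
    simp only [setHeights]
    split_ifs with h1 h2 h3
    · rw [h1, ha]
    · rw [h2, hb]
    · rw [h3, hi]
    · rfl
  rw [zero_add e] at h2
  have h3 := h1.seq h2
  simp only [zero_add, e0, List.append_nil] at h3
  exact h3.mono (le_of_eq (by ring))

/-! ## Programs for the gadgets -/

/-- Positions of the qubits: `n` in registers `1` and `2`, and the number `v` of possible values of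
the counter in registers `3` and `4` (the latter plus one). -/
def auxHeights (n v : ℕ) : ℕ → ℕ :=
  fun j => if j = 1 ∨ j = 2 then n else if j = 3 then v else if j = 4 then v + 1 else 0

/-- Program for `descend (ctrlSwap d) n`. -/
def swapProg (M d : ℕ) : Prog :=
  countdown M 1 2 5 (emitAll [.cnot (d, M + 1) (0, M + 1),
    .toffoli (1, M + 0) (0, M + 1) (d, M + 1), .cnot (d, M + 1) (0, M + 1)])

/-- Program for `descend (entangle M) n`. -/
def entangleProg (M : ℕ) : Prog :=
  countdown M 1 2 5 (emitAll [.hadamard (M, M + 1), .cnot (M, M + 1) (M + 1, M + 1)])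

/-- Program for `descend (counterGate (M + 2)) v`. -/
def counterProg (M : ℕ) : Prog :=
  countdown M 3 4 5 (emitAll [.toffoli (1, M + 0) (M + 2, M + 3) (M + 2, M + 4)])

theorem execLE_swapProg (M d n v : ℕ) (s : Store) :
    ExecLE (swapProg M d) (mix M s (auxHeights n v)) (descend (ctrlSwap d) n)
      (n * (6 * n + 12) + 2) (mix M s (auxHeights n v)) := by
  -- Offset `0`: a swap uses one position only, and register `2` is a mere companion of register
  -- `1`.
  refine (execLE_countdown M (by decide) (by decide) (by decide) _ s _ 0 (6 * n + 4) _ n ?_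
    (by simp [auxHeights]) (by simp [auxHeights]) (by simp [auxHeights])).mono (le_of_eq (by ring))
  intro u hu k
  have h := execLE_emitAll [.cnot (d, M + 1) (0, M + 1),
    .toffoli (1, M + 0) (0, M + 1) (d, M + 1), .cnot (d, M + 1) (0, M + 1)]
    (mix M s (setHeights (auxHeights n v) 1 2 5 u (u + 0) k))
  simp only [List.map_cons, List.map_nil, Gate.map, length_mix_add] at h
  refine h.mono ?_
  simp [totalCost, Gate.cost, setHeights, auxHeights]
  omega

theorem execLE_entangleProg (M n v : ℕ) (s : Store) :
    ExecLE (entangleProg M) (mix M s (auxHeights n v)) (descend (entangle M) n)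
      (n * (6 * n + 12) + 2) (mix M s (auxHeights n v)) := by
  refine (execLE_countdown M (by decide) (by decide) (by decide) _ s _ 0 (6 * n + 4) _ n ?_
    (by simp [auxHeights]) (by simp [auxHeights]) (by simp [auxHeights])).mono (le_of_eq (by ring))
  intro u hu k
  have h := execLE_emitAll [.hadamard (M, M + 1), .cnot (M, M + 1) (M + 1, M + 1)]
    (mix M s (setHeights (auxHeights n v) 1 2 5 u (u + 0) k))
  simp only [List.map_cons, List.map_nil, Gate.map, length_mix_add] at h
  refine h.mono ?_
  simp [totalCost, Gate.cost, setHeights]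
  omega

theorem execLE_counterProg (M n v : ℕ) (s : Store) :
    ExecLE (counterProg M) (mix M s (auxHeights n v)) (descend (counterGate (M + 2)) v)
      (v * (6 * v + 12) + 2) (mix M s (auxHeights n v)) := by
  -- Offset `1`: register `4` supplies the position `u + 1` of the Toffoli target.
  refine (execLE_countdown M (by decide) (by decide) (by decide) _ s _ 1 (6 * v + 4) _ v ?_
    (by simp [auxHeights]) (by simp [auxHeights]) (by simp [auxHeights])).mono (le_of_eq (by ring))
  intro u hu k
  have h := execLE_emitAll [.toffoli (1, M + 0) (M + 2, M + 3) (M + 2, M + 4)]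
    (mix M s (setHeights (auxHeights n v) 3 4 5 u (u + 1) k))
  simp only [List.map_cons, List.map_nil, Gate.map, length_mix_add] at h
  refine h.mono ?_
  simp [totalCost, Gate.cost, setHeights, auxHeights]
  omega

/-- Program for `gadget M n v o`. -/
def gadgetProg (M : ℕ) (o : QueryOp) : Prog :=
  .seq
    (if o.positive then .seq (counterProg M) (emitAll [.not (1, M + 0)])
      else .seq (emitAll [.not (1, M + 0)]) (counterProg M))
    (.seq (swapProg M (if o.left then M else M + 1))
      (.seq (emitAll [.not (1, M + 0), .query (.uncontrolled o), .not (1, M + 0)])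
        (.seq (swapProg M (if o.left then M else M + 1))
          (.seq (emitAll [.not (1, M + 0)])
            (.seq (.push (M + 3) true) (.push (M + 4) true))))))

theorem execLE_emitAll_not (M n v : ℕ) (s : Store) :
    ExecLE (emitAll [.not (1, M + 0)]) (mix M s (auxHeights n v)) [.not (1, 0)] 2
      (mix M s (auxHeights n v)) := by
  have h := execLE_emitAll [.not (1, M + 0)] (mix M s (auxHeights n v))
  simp only [List.map_cons, List.map_nil, Gate.map, length_mix_add] at h
  exact h

theorem execLE_push_auxHeights (M n v : ℕ) (s : Store) :
    ExecLE (.seq (.push (M + 3) true) (.push (M + 4) true)) (mix M s (auxHeights n v)) [] 2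
      (mix M s (auxHeights n (v + 1))) := by
  have h := (execLE_push M s (auxHeights n v) 3).seq_nil (execLE_push M s _ 4)
  convert h using 2
  funext j
  by_cases h3 : j = 3
  · subst h3
    simp [auxHeights]
  · by_cases h4 : j = 4
    · subst h4
      simp [auxHeights]
    · simp [auxHeights, h3, h4]

theorem execLE_gadgetProg (M n v : ℕ) (o : QueryOp) (s : Store) :
    ExecLE (gadgetProg M o) (mix M s (auxHeights n v)) (gadget M n v o)
      (100 * (n + v + 1) ^ 2) (mix M s (auxHeights n (v + 1))) := by
  have hn := execLE_emitAll_not M n v s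
  have hc := execLE_counterProg M n v s
  have hs := execLE_swapProg M (if o.left then M else M + 1) n v s
  have hq : ExecLE (emitAll [.not (1, M + 0), .query (.uncontrolled o), .not (1, M + 0)])
      (mix M s (auxHeights n v)) [.not (1, 0), .query (.uncontrolled o), .not (1, 0)] 4
      (mix M s (auxHeights n v)) := by
    have h := execLE_emitAll [.not (1, M + 0), .query (.uncontrolled o), .not (1, M + 0)]
      (mix M s (auxHeights n v))
    simp only [List.map_cons, List.map_nil, Gate.map, length_mix_add] at h
    exact h
  have hfirst : ExecLE (if o.positive then .seq (counterProg M) (emitAll [.not (1, M + 0)])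
        else .seq (emitAll [.not (1, M + 0)]) (counterProg M)) (mix M s (auxHeights n v))
      (if o.positive then descend (counterGate (M + 2)) v ++ [.not (1, 0)]
        else [.not (1, 0)] ++ descend (counterGate (M + 2)) v)
      (v * (6 * v + 12) + 4) (mix M s (auxHeights n v)) := by
    cases o.positive
    · exact (hn.seq hc).mono (by omega)
    · exact (hc.seq hn).mono (by omega)
  have h := hfirst.seq (hs.seq (hq.seq (hs.seq (hn.seq (execLE_push_auxHeights M n v s)))))
  have hB : v * (6 * v + 12) + 4 + (n * (6 * n + 12) + 2 + (4 + (n * (6 * n + 12) + 2 + (2 + 2))))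
      ≤ 100 * (n + v + 1) ^ 2 := by nlinarith [Nat.zero_le (n * v), Nat.zero_le n, Nat.zero_le v]
  have hcirc : gadget M n v o = (if o.positive then descend (counterGate (M + 2)) v ++ [.not (1, 0)]
        else [.not (1, 0)] ++ descend (counterGate (M + 2)) v) ++
      (descend (ctrlSwap (if o.left then M else M + 1)) n ++
        ([.not (1, 0), .query (.uncontrolled o), .not (1, 0)] ++
          (descend (ctrlSwap (if o.left then M else M + 1)) n ++ ([.not (1, 0)] ++ [])))) := by
    simp only [gadget, redirect, List.append_assoc, List.append_nil]
  rw [hcirc]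
  exact h.mono hB

/-! ## Simulation of programs -/

/-- All registers in the gate are below `M`. -/
def Gate.PositionsLT (M : ℕ) : Gate ℕ → Prop
  | .not a => a.2 < M
  | .cnot a b => a.2 < M ∧ b.2 < M
  | .toffoli a b c => a.2 < M ∧ b.2 < M ∧ c.2 < M
  | .hadamard a => a.2 < M
  | .phase j a => j < M ∧ a.2 < M
  | .query _ => True

/-- The program only uses registers and arrays below `M`. -/
def Prog.BoundedBy (M : ℕ) : Prog → Prop
  | .skip => True
  | .push r _ => r < M
  | .pop r => r < M
  | .emit g => g.ArraysLT M ∧ g.PositionsLT M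
  | .seq p q => p.BoundedBy M ∧ q.BoundedBy M
  | .branch r p q t => r < M ∧ p.BoundedBy M ∧ q.BoundedBy M ∧ t.BoundedBy M
  | .loop r p => r < M ∧ p.BoundedBy M

theorem Prog.eventually_boundedBy (P : Prog) : ∀ᶠ M in atTop, P.BoundedBy M := by
  induction P with
  | skip => exact Eventually.of_forall fun _ => trivial
  | push r b => exact eventually_gt_atTop r
  | pop r => exact eventually_gt_atTop r
  | emit g =>
    cases g with
    | not a => exact (eventually_gt_atTop a.1).and (eventually_gt_atTop a.2)
    | cnot a b =>
      exact ((eventually_gt_atTop a.1).and (eventually_gt_atTop b.1)).and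
        ((eventually_gt_atTop a.2).and (eventually_gt_atTop b.2))
    | toffoli a b c =>
      exact ((eventually_gt_atTop a.1).and
          ((eventually_gt_atTop b.1).and (eventually_gt_atTop c.1))).and
        ((eventually_gt_atTop a.2).and ((eventually_gt_atTop b.2).and (eventually_gt_atTop c.2)))
    | hadamard a => exact (eventually_gt_atTop a.1).and (eventually_gt_atTop a.2)
    | phase j a =>
      exact (eventually_gt_atTop a.1).and ((eventually_gt_atTop j).and (eventually_gt_atTop a.2))
    | query q => exact (eventually_gt_atTop 1).and (Eventually.of_forall fun _ => trivial)
  | seq p q hp hq => exact hp.and hq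
  | branch r p q t hp hq ht => exact (eventually_gt_atTop r).and (hp.and (hq.and ht))
  | loop r p hp => exact (eventually_gt_atTop r).and hp

theorem Gate.arraysLT_map {M : ℕ} {g : Gate ℕ} (hg : g.ArraysLT M) (f : ℕ → ℕ) :
    (g.map f).ArraysLT M := by
  cases g <;> exact hg

theorem Exec.arraysLT {M : ℕ} {P : Prog} {s s' : Store} {c : Circuit} {t : ℕ}
    (h : Exec P s c t s') (hP : P.BoundedBy M) : ∀ g ∈ c, g.ArraysLT M := by
  induction h with
  | emit g s =>
    intro g' hg'
    rw [List.mem_singleton.mp hg']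
    exact Gate.arraysLT_map hP.1 _
  | seq _ _ h1 h2 =>
    intro g hg
    rcases List.mem_append.mp hg with hg | hg
    exacts [h1 hP.1 g hg, h2 hP.2 g hg]
  | branchEmpty _ _ h => exact h hP.2.1
  | branchFalse _ _ h => exact h hP.2.2.1
  | branchTrue _ _ h => exact h hP.2.2.2
  | loopStep _ _ _ h1 h2 =>
    intro g hg
    rcases List.mem_append.mp hg with hg | hg
    exacts [h1 hP.2 g hg, h2 hP g hg]
  | _ => simp

theorem controlledCount_append (c d : Circuit) :
    controlledCount (c ++ d) = controlledCount c + controlledCount d := by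
  simp [controlledCount, List.filterMap_append]

theorem Gate.one_le_cost (g : Gate ℕ) : 1 ≤ g.cost := by
  cases g <;> simp [Gate.cost]

theorem Exec.controlledCount_le {P : Prog} {s s' : Store} {c : Circuit} {t : ℕ}
    (h : Exec P s c t s') : controlledCount c ≤ t := by
  induction h with
  | emit g s =>
    refine le_trans ?_ (Gate.one_le_cost _)
    exact List.length_filterMap_le _ _
  | seq _ _ h1 h2 =>
    rw [controlledCount_append]
    omega
  | loopStep _ _ _ h1 h2 =>
    rw [controlledCount_append]
    omega
  | branchEmpty _ _ h => omega
  | branchFalse _ _ h => omega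
  | branchTrue _ _ h => omega
  | _ => simp [controlledCount]

theorem simulate_append (M n v : ℕ) (c d : Circuit) :
    simulate M n v (c ++ d) = simulate M n v c ++ simulate M n (v + controlledCount c) d := by
  induction c generalizing v with
  | nil => rfl
  | cons g c ih =>
    cases hg : g.controlledOp with
    | none =>
      have : controlledCount (g :: c) = controlledCount c := by simp [controlledCount, hg]
      simp only [List.cons_append, simulate, hg, ih, this]
    | some o =>
      have : v + controlledCount (g :: c) = v + 1 + controlledCount c := by
        simp [controlledCount, hg]
        omega
      simp only [List.cons_append, simulate, hg, ih, this, List.append_assoc]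

/-- The program that runs `P` with controlled queries replaced by gadgets. -/
def simulateProg (M : ℕ) : Prog → Prog
  | .emit g =>
    match g.controlledOp with
    | some o => gadgetProg M o
    | none => .emit g
  | .seq p q => .seq (simulateProg M p) (simulateProg M q)
  | .branch r p q t => .branch r (simulateProg M p) (simulateProg M q) (simulateProg M t)
  | .loop r p => .loop r (simulateProg M p)
  | .skip => .skip
  | .push r b => .push r b
  | .pop r => .pop r

theorem Gate.map_congr_of_positionsLT {M : ℕ} {g : Gate ℕ} (hg : g.PositionsLT M) {f f' : ℕ → ℕ}
    (h : ∀ r < M, f r = f' r) : g.map f = g.map f' := by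
  cases g with
  | not a => simp only [Gate.map, h _ hg]
  | cnot a b => simp only [Gate.map, h _ hg.1, h _ hg.2]
  | toffoli a b c => simp only [Gate.map, h _ hg.1, h _ hg.2.1, h _ hg.2.2]
  | hadamard a => simp only [Gate.map, h _ hg]
  | phase j a => simp only [Gate.map, h _ hg.1, h _ hg.2]
  | query q => rfl

theorem Gate.controlledOp_map (g : Gate ℕ) (f : ℕ → ℕ) :
    (g.map f).controlledOp = g.controlledOp := by
  cases g <;> rfl

/-- The inserted code leaves registers below `M` as they were, so all tests and loops of the
original run take the same course. `K` bounds the counter size during the whole run, so one factor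
covers the cost of any gadget; an original step emits at most one. -/
theorem Exec.simulate {M : ℕ} (n : ℕ) {P : Prog} {s s' : Store} {c : Circuit} {t : ℕ}
    (h : Exec P s c t s') (hP : P.BoundedBy M) (v K : ℕ) (hK : v + controlledCount c ≤ K) :
    ExecLE (simulateProg M P) (mix M s (auxHeights n v)) (simulate M n v c)
      (t * (100 * (n + K + 1) ^ 2)) (mix M s' (auxHeights n (v + controlledCount c))) := by
  have hG : 1 ≤ 100 * (n + K + 1) ^ 2 := Nat.succ_le_of_lt (by positivity)
  induction h generalizing v with
  | skip s => exact ((Exec.skip _).execLE).mono (by omega)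
  | push r b s =>
    have := Exec.push r b (mix M s (auxHeights n v))
    rw [mix_of_lt _ _ hP, update_mix_of_lt _ _ hP] at this
    exact this.execLE.mono (by omega)
  | pop r s =>
    have := Exec.pop r (mix M s (auxHeights n v))
    rw [mix_of_lt _ _ hP, update_mix_of_lt _ _ hP] at this
    exact this.execLE.mono (by omega)
  | emit g s =>
    cases hg : g.controlledOp with
    | none =>
      have h := Exec.emit g (mix M s (auxHeights n v))
      have e : (g.map fun r => (mix M s (auxHeights n v) r).length) =
          g.map fun r => (s r).length :=
        Gate.map_congr_of_positionsLT hP.2 fun r hr => by rw [mix_of_lt _ _ hr]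
      rw [e] at h
      simp only [simulateProg, PRU.simulate, hg, Gate.controlledOp_map, controlledCount,
        List.filterMap_cons_none, List.filterMap_nil, List.length_nil, add_zero]
      exact h.execLE.mono (Nat.le_mul_of_pos_right _ hG)
    | some o =>
      have hone : controlledCount [g.map fun r => (s r).length] = 1 := by
        simp [controlledCount, Gate.controlledOp_map, hg]
      rw [hone] at hK ⊢
      simp only [simulateProg, PRU.simulate, hg, Gate.controlledOp_map, List.append_nil]
      refine (execLE_gadgetProg M n v o s).mono ?_
      calc 100 * (n + v + 1) ^ 2 ≤ 1 * (100 * (n + K + 1) ^ 2) := by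
            rw [one_mul]
            gcongr
            omega
        _ ≤ _ := Nat.mul_le_mul_right _ (Gate.one_le_cost _)
  | seq _ _ h1 h2 =>
    rw [controlledCount_append] at hK
    rw [simulate_append, controlledCount_append, ← add_assoc, add_mul]
    exact (h1 hP.1 v (by omega)).seq (h2 hP.2 _ (by omega))
  | branchEmpty hs _ h =>
    obtain ⟨t', ht', h'⟩ := h hP.2.1 v hK
    exact ⟨t' + 1, by rw [add_mul]; omega,
      .branchEmpty (by rw [mix_of_lt _ _ hP.1]; exact hs) h'⟩
  | branchFalse hs _ h =>
    obtain ⟨t', ht', h'⟩ := h hP.2.2.1 v hK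
    exact ⟨t' + 1, by rw [add_mul]; omega,
      .branchFalse (by rw [mix_of_lt _ _ hP.1]; exact hs) h'⟩
  | branchTrue hs _ h =>
    obtain ⟨t', ht', h'⟩ := h hP.2.2.2 v hK
    exact ⟨t' + 1, by rw [add_mul]; omega,
      .branchTrue (by rw [mix_of_lt _ _ hP.1]; exact hs) h'⟩
  | loopDone hs =>
    exact ((Exec.loopDone (by rw [mix_of_lt _ _ hP.1]; exact hs)).execLE).mono (by omega)
  | loopStep hs _ _ h1 h2 =>
    rw [controlledCount_append] at hK
    rw [simulate_append, controlledCount_append, ← add_assoc, add_mul, add_mul]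
    refine (ExecLE.loopStep (by rw [mix_of_lt _ _ hP.1]; exact hs) (h1 hP.2 v (by omega))
      (h2 hP _ (by omega))).mono (by omega)

/-! ## Preparation -/

/-- Copy register `0` to registers `M + 1` and `M + 2`. -/
def copyProg (M : ℕ) : Prog :=
  .seq
    (.loop 0 (.seq (.pop 0) (.seq (.push (M + 1) true) (.seq (.push (M + 2) true)
      (.push (M + 5) true)))))
    (.loop (M + 5) (.seq (.pop (M + 5)) (.push 0 true)))

/-- Heights of the registers in the course of copying. -/
def copyHeights (n k : ℕ) : ℕ → ℕ := fun j => if j = 1 ∨ j = 2 then n else if j = 5 then k else 0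

theorem execLE_copyProg {M : ℕ} (hM : 0 < M) (s : Store) (n : ℕ)
    (hs : s 0 = List.replicate n true) :
    ExecLE (copyProg M) (mix M s fun _ => 0) [] (8 * n + 2) (mix M s (copyHeights n 0)) := by
  -- First loop: register `0` empties while both copies and the backup register `5` fill up.
  have h1 : ∀ i k, ExecLE (.loop 0 (.seq (.pop 0) (.seq (.push (M + 1) true)
        (.seq (.push (M + 2) true) (.push (M + 5) true)))))
      (mix M (Function.update s 0 (List.replicate i true)) (copyHeights k k)) [] (5 * i + 1)
      (mix M (Function.update s 0 []) (copyHeights (k + i) (k + i))) := by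
    intro i
    induction i with
    | zero =>
      intro k
      exact (Exec.loopDone (by rw [mix_of_lt _ _ hM]; simp)).execLE
    | succ i ih =>
      intro k
      have hpop := Exec.pop 0 (mix M (Function.update s 0 (List.replicate (i + 1) true))
        (copyHeights k k))
      rw [mix_of_lt _ _ hM, update_mix_of_lt _ _ hM, Function.update_idem, Function.update_self,
        List.tail_replicate, Nat.add_sub_cancel] at hpop
      have hpush := (execLE_push M (Function.update s 0 (List.replicate i true))
        (copyHeights k k) 1).seq_nil ((execLE_push M _ _ 2).seq_nil (execLE_push M _ _ 5))
      have e : Function.update (Function.update (Function.update (copyHeights k k) 1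
          (copyHeights k k 1 + 1)) 2 (Function.update (copyHeights k k) 1
          (copyHeights k k 1 + 1) 2 + 1)) 5 (Function.update (Function.update (copyHeights k k) 1
          (copyHeights k k 1 + 1)) 2 (Function.update (copyHeights k k) 1
          (copyHeights k k 1 + 1) 2 + 1) 5 + 1) = copyHeights (k + 1) (k + 1) := by
        funext j
        by_cases h1 : j = 1
        · simp [copyHeights, h1]
        · by_cases h2 : j = 2
          · simp [copyHeights, h2]
          · by_cases h5 : j = 5
            · simp [copyHeights, h5]
            · simp [copyHeights, h1, h2, h5]
      rw [e] at hpush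
      have h3 := ih (k + 1)
      rw [add_assoc, add_comm 1 i] at h3
      exact (ExecLE.loopStep (c := []) (by rw [mix_of_lt _ _ hM]; simp)
        (hpop.execLE.seq_nil hpush) h3).mono (by omega)
  -- Second loop: register `0` is refilled from the backup.
  have h2 : ∀ k i, ExecLE (.loop (M + 5) (.seq (.pop (M + 5)) (.push 0 true)))
      (mix M (Function.update s 0 (List.replicate i true)) (copyHeights n k)) [] (3 * k + 1)
      (mix M (Function.update s 0 (List.replicate (i + k) true)) (copyHeights n 0)) := by
    intro k
    induction k with
    | zero => exact fun i => execLE_loop_zero M _ (by simp [copyHeights]) _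
    | succ k ih =>
      intro i
      have hpop := execLE_pop M (Function.update s 0 (List.replicate i true))
        (copyHeights n (k + 1)) 5
      have e : Function.update (copyHeights n (k + 1)) 5 (copyHeights n (k + 1) 5 - 1) =
          copyHeights n k := by
        funext j
        by_cases h5 : j = 5
        · simp [copyHeights, h5]
        · simp [copyHeights, h5]
      rw [e] at hpop
      have hpush := Exec.push 0 true (mix M (Function.update s 0 (List.replicate i true))
        (copyHeights n k))
      rw [mix_of_lt _ _ hM, update_mix_of_lt _ _ hM, Function.update_idem, Function.update_self,
        ← List.replicate_succ] at hpush
      have h3 := ih (i + 1)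
      rw [add_assoc, add_comm 1 k] at h3
      exact (ExecLE.loopStep (c := []) (mix_add_ne_nil M _ (by simp [copyHeights]))
        (hpop.seq_nil hpush.execLE) h3).mono (by omega)
  have e0 : copyHeights 0 0 = fun _ => 0 := by
    funext j
    simp [copyHeights]
  have h3 := h1 n 0
  have h4 := h2 n 0
  rw [← hs, Function.update_eq_self, e0, zero_add] at h3
  rw [zero_add, ← hs, Function.update_eq_self] at h4
  have h3 := h3.seq_nil h4
  exact h3.mono (by omega)

theorem mix_inputStore {M : ℕ} (hM : 2 < M) (n : ℕ) (w : List Bool) (m : ℕ) :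
    mix M (inputStore n w m) (fun _ => 0) = inputStore n w m := by
  funext r
  by_cases hr : r < M
  · exact mix_of_lt _ _ hr
  · rw [mix, if_neg hr]
    match r, hr with
    | 0, h => omega
    | 1, h => omega
    | 2, h => omega
    | r + 3, _ => rfl

/-- Preparation of the registers, the counter and the entangled state. -/
def prepareProg (M : ℕ) : Prog :=
  .seq (copyProg M) (.seq (.seq (.push (M + 4) true) (.seq (.push (M + 3) true)
    (.push (M + 4) true))) (.seq (emitAll [.not (M + 2, M + 0)]) (entangleProg M)))

theorem execLE_prepareProg {M : ℕ} (hM : 2 < M) (n : ℕ) (w : List Bool) (m : ℕ) :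
    ExecLE (prepareProg M) (inputStore n w m) (prepare M n) (100 * (n + 1) ^ 2)
      (mix M (inputStore n w m) (auxHeights n 1)) := by
  have h1 := execLE_copyProg (by omega : 0 < M) (inputStore n w m) n rfl
  rw [mix_inputStore hM] at h1
  -- One extra push on register `4` gives the heights for `v = 0`. The joint push then yields `v =
  -- 1`, the right size for the initial counter `{0}`.
  have h2 := execLE_push M (inputStore n w m) (copyHeights n 0) 4
  have e : Function.update (copyHeights n 0) 4 (copyHeights n 0 4 + 1) = auxHeights n 0 := by
    funext j
    by_cases h4 : j = 4
    · simp [auxHeights, copyHeights, h4]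
    · simp [auxHeights, copyHeights, h4]
  rw [e] at h2
  have h3 := h2.seq_nil (execLE_push_auxHeights M n 0 (inputStore n w m))
  have h4 := execLE_emitAll [.not (M + 2, M + 0)] (mix M (inputStore n w m) (auxHeights n (0 + 1)))
  simp only [List.map_cons, List.map_nil, Gate.map, length_mix_add] at h4
  have h5 := h1.seq_nil (h3.seq_nil (h4.seq (execLE_entangleProg M n (0 + 1) (inputStore n w m))))
  refine h5.mono ?_
  simp [totalCost, Gate.cost, auxHeights]
  nlinarith [Nat.zero_le n]

/-! ### The security reduction: admissible queries, running time and advantage. -/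

theorem allowed_simulate {M n : ℕ} {S : Set QueryOp} {c : Circuit}
    (hc : c.Allowed (Query.controlled '' S)) (v : ℕ) :
    Circuit.Allowed (Query.uncontrolled '' S) (simulate M n v c) := by
  have hcounter : ∀ C v, ∀ g ∈ descend (counterGate C) v, g.Allowed (Query.uncontrolled '' S) := by
    intro C v
    induction v with
    | zero => simp [descend]
    | succ v ih =>
      intro g hg
      rcases List.mem_append.mp hg with hg | hg
      · rw [List.mem_singleton.mp hg]
        trivial
      · exact ih g hg
  have hswap : ∀ d v, ∀ g ∈ descend (ctrlSwap d) v, g.Allowed (Query.uncontrolled '' S) := by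
    intro d v
    induction v with
    | zero => simp [descend]
    | succ v ih =>
      intro g hg
      rcases List.mem_append.mp hg with hg | hg
      · simp only [ctrlSwap, List.mem_cons, List.not_mem_nil, or_false] at hg
        rcases hg with rfl | rfl | rfl <;> trivial
      · exact ih g hg
  induction c generalizing v with
  | nil => simp [simulate, Circuit.Allowed]
  | cons g c ih =>
    have ih' := ih fun g hg => hc g (List.mem_cons_of_mem _ hg)
    have hg0 := hc g List.mem_cons_self
    intro g' hg'
    cases hg : g.controlledOp with
    | none =>
      simp only [simulate, hg] at hg'
      rcases List.mem_cons.mp hg' with rfl | h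
      · cases g' with
        | query q =>
          obtain ⟨o, -, rfl⟩ := hg0
          simp [Gate.controlledOp] at hg
        | _ => trivial
      · exact ih' _ g' h
    | some o =>
      obtain rfl := Gate.eq_of_controlledOp_eq_some hg
      obtain ⟨o', ho', heq⟩ := hg0
      obtain rfl : o' = o := by simpa using heq
      simp only [simulate, Gate.controlledOp] at hg'
      rcases List.mem_append.mp hg' with h | h
      · simp only [gadget, redirect, List.mem_append, List.mem_cons, List.not_mem_nil,
          or_false] at h
        rcases h with h | (((h | h | h | h) | h) | h)
        · split_ifs at h
          · rcases List.mem_append.mp h with h | h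
            · exact hcounter _ _ _ h
            · rw [List.mem_singleton.mp h]
              trivial
          · rcases List.mem_append.mp h with h | h
            · rw [List.mem_singleton.mp h]
              trivial
            · exact hcounter _ _ _ h
        · exact hswap _ _ _ h
        · rw [h]
          trivial
        · rw [h]
          exact ⟨o', ho', rfl⟩
        · rw [h]
          trivial
        · exact hswap _ _ _ h
        · rw [h]
          trivial
      · exact ih' _ g' h

theorem allowed_prepare (M n : ℕ) (Q : Set Query) : Circuit.Allowed Q (prepare M n) := by
  have h : ∀ v, ∀ g ∈ descend (entangle M) v, g.Allowed Q := by
    intro v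
    induction v with
    | zero => simp [descend]
    | succ v ih =>
      intro g hg
      rcases List.mem_append.mp hg with hg | hg
      · simp only [entangle, List.mem_cons, List.not_mem_nil, or_false] at hg
        rcases hg with rfl | rfl <;> trivial
      · exact ih g hg
  intro g hg
  rcases List.mem_cons.mp hg with rfl | hg
  · trivial
  · exact h n g hg

/-- The program size determines an `M` independent of `n`, leaving room for the ancillas and for the
output qubit. Advice is passed on unchanged, so both adversary models are covered at once. -/
theorem isEfficientOracleCircuit_simulate {S : Set QueryOp} {u : Uniformity} {c : ℕ → Circuit}
    (hc : IsEfficientOracleCircuit (Query.controlled '' S) u c) :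
    ∃ (M : ℕ) (p : Polynomial ℕ), 2 < M ∧
      IsEfficientOracleCircuit (Query.uncontrolled '' S) u
        (fun n => prepare M n ++ simulate M n 1 (c n)) ∧
      ∀ n, 1 ≤ n → (c n).Allowed (Query.controlled '' S) ∧ (∀ g ∈ c n, g.ArraysLT M) ∧
        controlledCount (c n) ≤ p.eval n := by
  obtain ⟨P, p, a, ha, h⟩ := hc
  obtain ⟨M, hP, hM⟩ := (P.eventually_boundedBy.and (eventually_gt_atTop 2)).exists
  refine ⟨M, p, hM, ⟨.seq (prepareProg M) (simulateProg M P),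
    Polynomial.C 100 * (Polynomial.X + 1) ^ 2 +
      p * (Polynomial.C 100 * (Polynomial.X + (1 + p) + 1) ^ 2), a, ha, fun n hn => ?_⟩,
    fun n hn => ?_⟩
  · obtain ⟨hA, t, s, hE, ht⟩ := h n hn
    refine ⟨fun g hg => ?_, ?_⟩
    · rcases List.mem_append.mp hg with hg | hg
      exacts [allowed_prepare M n _ g hg, allowed_simulate hA 1 g hg]
    · have h1 := execLE_prepareProg hM n (a n) 0
      -- Each controlled query costs at least one step, so the running time bounds how far the
      -- counter can grow.
      have h2 := hE.simulate n hP 1 (1 + p.eval n)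
        (Nat.add_le_add_left (hE.controlledCount_le.trans ht) 1)
      obtain ⟨t', ht', hE'⟩ := h1.seq h2
      refine ⟨t', _, hE', ht'.trans ?_⟩
      simp only [Polynomial.eval_add, Polynomial.eval_mul, Polynomial.eval_pow, Polynomial.eval_C,
        Polynomial.eval_X, Polynomial.eval_one]
      gcongr
  · obtain ⟨hA, t, s, hE, ht⟩ := h n hn
    exact ⟨hA, hE.arraysLT hP, hE.controlledCount_le.trans ht⟩

theorem eventually_eval_lt_two_pow (p : Polynomial ℕ) : ∀ᶠ n : ℕ in atTop, p.eval n < 2 ^ n := by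
  have h : (fun n : ℕ => ((p.eval n : ℕ) : ℝ)) =o[atTop] fun n => (2 : ℝ) ^ n := by
    induction p using Polynomial.induction_on' with
    | add p q hp hq =>
      simp only [Polynomial.eval_add, Nat.cast_add]
      exact hp.add hq
    | monomial k a =>
      simp only [Polynomial.eval_monomial, Nat.cast_mul, Nat.cast_pow]
      exact (isLittleO_pow_const_const_pow_of_one_lt k (by norm_num)).const_mul_left _
  filter_upwards [h.bound (show (0 : ℝ) < 1 / 2 by norm_num)] with n hn
  rw [Real.norm_of_nonneg (by positivity), Real.norm_of_nonneg (by positivity)] at hn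
  have h2 : (0 : ℝ) < 2 ^ n := by positivity
  have : ((p.eval n : ℕ) : ℝ) < 2 ^ n := by linarith
  exact_mod_cast this

theorem UnitaryFamily.IndistinguishableFromHaar.withPhase {𝒰 : UnitaryFamily} {S : Set QueryOp}
    {u : Uniformity} (h : 𝒰.IndistinguishableFromHaar (Query.uncontrolled '' S) u) :
    𝒰.withPhase.IndistinguishableFromHaar (Query.controlled '' S) u := by
  intro c hc
  obtain ⟨M, p, hM, hc', hcM⟩ := isEfficientOracleCircuit_simulate hc
  -- The two advantages agree exactly for large `n`, and negligibility depends only on large `n`.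
  refine (h _ hc').congr' ?_
  filter_upwards [eventually_ge_atTop 1, eventually_eval_lt_two_pow p] with n hn hp
  obtain ⟨hA, hM', hcount⟩ := hcM n hn
  rw [keyAcceptProb_withPhase 𝒰 hM (c n) hA hM' (hcount.trans_lt hp),
    haarAcceptProb_simulate hM (c n) hA hM' (hcount.trans_lt hp)]

/-! ## Efficient generation -/

/-- Multiplication by the global phase `exp(2πi / 2^j)`. -/
def globalPhase (j : ℕ) : Circuit :=
  [.phase j (0, 0), .not (0, 0), .phase j (0, 0), .not (0, 0)]

/-- The phase gate acts once on each value of the qubit, before or after the flip, so the phase is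
global. -/
theorem runLin_globalPhase {n : ℕ} (V : QMatrix n) (j : ℕ) (ψ : State) :
    runLin V (globalPhase j) ψ = Complex.exp (2 * Real.pi * Complex.I / 2 ^ j) • ψ := by
  have : runLin V (globalPhase j) =
      Complex.exp (2 * Real.pi * Complex.I / 2 ^ j) • LinearMap.id := hom_ext_ket fun s => by
    by_cases h : ((0, 0) : Wire) ∈ s <;>
      simp [globalPhase, runLin_cons, runLin_nil, extend_ket, Gate.onBasis, h, not_mem_flip_self,
        flip_flip]
  rw [this]
  rfl

/-- The circuit that multiplies by the global phase with binary digits `w`. -/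
def phaseCircuit : List Bool → Circuit
  | [] => []
  | b :: w => (if b then globalPhase (w.length + 1) else []) ++ phaseCircuit w

/-- The lowest bit carries weight `2 ^ (-k)`, and what remains is `x / 2` over `2 ^ (k - 1)`. Thus
the order of the phase gate is the number of digits left. -/
theorem runLin_phaseCircuit {n : ℕ} (V : QMatrix n) (k x : ℕ) (ψ : State) :
    runLin V (phaseCircuit (List.ofFn fun i : Fin k => x.testBit i)) ψ =
      Complex.exp (2 * Real.pi * Complex.I * (x : ℂ) / 2 ^ k) • ψ := by
  induction k generalizing x ψ with
  | zero =>
    have : Complex.exp (2 * Real.pi * Complex.I * (x : ℂ) / 2 ^ 0) = 1 := by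
      rw [pow_zero, div_one, mul_comm]
      exact Complex.exp_nat_mul_two_pi_mul_I x
    rw [this, one_smul]
    rfl
  | succ k ih =>
    have hx : (x : ℂ) = ((x % 2 : ℕ) : ℂ) + 2 * ((x / 2 : ℕ) : ℂ) := by
      exact_mod_cast (Nat.mod_add_div x 2).symm
    have hsucc : (fun i : Fin k => x.testBit (i.succ : Fin (k + 1))) =
        fun i : Fin k => (x / 2).testBit i := by
      funext i
      rw [Fin.val_succ, Nat.testBit_succ]
    have hk : (2 : ℂ) ^ k ≠ 0 := pow_ne_zero _ two_ne_zero
    have hexp : Complex.exp (2 * Real.pi * Complex.I * (x : ℂ) / 2 ^ (k + 1)) =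
        Complex.exp (2 * Real.pi * Complex.I * ((x / 2 : ℕ) : ℂ) / 2 ^ k) *
          Complex.exp (2 * Real.pi * Complex.I * ((x % 2 : ℕ) : ℂ) / 2 ^ (k + 1)) := by
      rw [← Complex.exp_add, hx, pow_succ]
      congr 1
      field_simp
      ring
    rw [List.ofFn_succ, phaseCircuit, runLin_append, hsucc, ih, hexp, mul_smul]
    congr 1
    rw [Fin.val_zero, Nat.testBit_zero, List.length_ofFn]
    rcases Nat.mod_two_eq_zero_or_one x with h | h
    · simp [h, runLin_nil]
    · simp [h, runLin_globalPhase]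

/-- Program for `phaseCircuit`: the digits are on top of register `1`, and their number is in the
registers `4` and `5`. -/
def phaseProg : Prog :=
  .loop (3 + 1) (.seq (.branch 1 .skip .skip (emitAll [.phase (3 + 1) (0, 3 + 0), .not (0, 3 + 0),
    .phase (3 + 1) (0, 3 + 0), .not (0, 3 + 0)]))
      (.seq (.pop 1) (.seq (.pop (3 + 1)) (.pop (3 + 2)))))

/-- Register `4` both drives the loop and supplies the order of the phase gate, as its height is the
number of unread digits. -/
theorem execLE_phaseProg (s : Store) (w l : List Bool) :
    ExecLE phaseProg (mix 3 (Function.update s 1 (w ++ l)) (copyHeights w.length 0))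
      (phaseCircuit w) (w.length * (2 * w.length + 10) + 1)
      (mix 3 (Function.update s 1 l) fun _ => 0) := by
  induction w with
  | nil =>
    have e0 : copyHeights 0 0 = fun _ => 0 := by
      funext j
      simp [copyHeights]
    have := execLE_loop_zero 3 (Function.update s 1 l) (h := fun _ => 0) (a := 1) rfl
      (.seq (.branch 1 .skip .skip (emitAll [.phase (3 + 1) (0, 3 + 0), .not (0, 3 + 0),
        .phase (3 + 1) (0, 3 + 0), .not (0, 3 + 0)]))
          (.seq (.pop 1) (.seq (.pop (3 + 1)) (.pop (3 + 2)))))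
    rw [List.length_nil, e0]
    exact this.mono (by omega)
  | cons b w ih =>
    set σ := mix 3 (Function.update s 1 (b :: w ++ l)) (copyHeights (w.length + 1) 0) with hσ
    have h1 : ExecLE (.branch 1 .skip .skip (emitAll [.phase (3 + 1) (0, 3 + 0), .not (0, 3 + 0),
        .phase (3 + 1) (0, 3 + 0), .not (0, 3 + 0)])) σ
        (if b then globalPhase (w.length + 1) else []) (2 * w.length + 8) σ := by
      have hhead : (σ 1).head? = some b := by
        rw [hσ, mix_of_lt _ _ (by omega), Function.update_self]
        rfl
      cases b
      · exact ⟨1 + 1, by omega, .branchFalse hhead (.skip _)⟩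
      · have h := execLE_emitAll [.phase (3 + 1) (0, 3 + 0), .not (0, 3 + 0),
          .phase (3 + 1) (0, 3 + 0), .not (0, 3 + 0)] σ
        simp only [hσ, List.map_cons, List.map_nil, Gate.map, length_mix_add] at h
        rw [← hσ] at h
        obtain ⟨t, ht, hE⟩ := h
        refine ⟨t + 1, ?_, .branchTrue hhead hE⟩
        simp [totalCost, Gate.cost, copyHeights] at ht
        omega
    have h2 := Exec.pop 1 σ
    have e2 : Function.update σ 1 (σ 1).tail =
        mix 3 (Function.update s 1 (w ++ l)) (copyHeights (w.length + 1) 0) := by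
      rw [hσ, mix_of_lt _ _ (by omega), update_mix_of_lt _ _ (by omega), Function.update_idem,
        Function.update_self]
      rfl
    rw [e2] at h2
    have h3 := (execLE_pop 3 (Function.update s 1 (w ++ l)) (copyHeights (w.length + 1) 0)
      1).seq_nil (execLE_pop 3 _ _ 2)
    have e3 : Function.update (Function.update (copyHeights (w.length + 1) 0) 1
        (copyHeights (w.length + 1) 0 1 - 1)) 2 (Function.update (copyHeights (w.length + 1) 0) 1
        (copyHeights (w.length + 1) 0 1 - 1) 2 - 1) = copyHeights w.length 0 := by
      funext j
      by_cases h1 : j = 1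
      · simp [copyHeights, h1]
      · by_cases h2 : j = 2
        · simp [copyHeights, h2]
        · simp [copyHeights, h1, h2]
    rw [e3] at h3
    have h4 := h1.seq (h2.execLE.seq_nil h3)
    rw [List.append_nil] at h4
    refine (ExecLE.loopStep (mix_add_ne_nil 3 _ (by simp [copyHeights])) h4 ih).mono ?_
    simp only [List.length_cons]
    nlinarith

theorem normSq_smul {φ : ℂ} (hφ : ‖φ‖ = 1) (ψ : State) : normSq (φ • ψ) = normSq ψ := by
  rw [normSq_eq_sum (Finsupp.support_smul (b := φ) (g := ψ)), normSq_eq_sum subset_rfl]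
  simp [hφ]

/-- The phase is implemented exactly and has modulus one, so the error bound is unchanged. -/
theorem computes_phase {n : ℕ} {c : Circuit} {W : QUnitary n} {ε : ℝ}
    (h : Computes c (W : QMatrix n) ε) (x : Fin (2 ^ n)) :
    Computes (phaseCircuit (bits n x) ++ c) (phaseMul x W : QMatrix n) ε := by
  intro ψ
  have h1 : embed ((phaseMul x W : QMatrix n).mulVec ψ) =
      rootPhase n x • embed ((W : QMatrix n).mulVec ψ) := by
    have : (phaseMul x W : QMatrix n) = rootPhase n x • (W : QMatrix n) := rfl
    rw [this, Matrix.smul_mulVec]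
    simp only [embed, Finset.smul_sum, Pi.smul_apply, smul_smul, smul_eq_mul]
  have h2 : runCircuit (1 : QMatrix n) (phaseCircuit (bits n x) ++ c) (embed ψ) =
      rootPhase n x • runCircuit (1 : QMatrix n) c (embed ψ) := by
    rw [runCircuit_eq_runLin, runCircuit_eq_runLin, runLin_append, bits, runLin_phaseCircuit,
      map_smul]
    rfl
  rw [h1, h2, ← smul_sub, l2norm, normSq_smul (norm_rootPhase n x)]
  exact h ψ

theorem allowed_phaseCircuit (Q : Set Query) (w : List Bool) :
    Circuit.Allowed Q (phaseCircuit w) := by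
  induction w with
  | nil => simp [phaseCircuit, Circuit.Allowed]
  | cons b w ih =>
    intro g hg
    rcases List.mem_append.mp hg with hg | hg
    · split_ifs at hg
      · simp only [globalPhase, List.mem_cons, List.not_mem_nil, or_false] at hg
        rcases hg with rfl | rfl | rfl | rfl <;> trivial
      · simp at hg
    · exact ih g hg

theorem UnitaryFamily.EfficientlyGenerated.withPhase {𝒰 : UnitaryFamily}
    (h : 𝒰.EfficientlyGenerated) : 𝒰.withPhase.EfficientlyGenerated := by
  obtain ⟨P, p, h⟩ := h
  refine ⟨.seq (.seq (copyProg 3) phaseProg) P,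
    Polynomial.C 100 * (Polynomial.X + 1) ^ 2 + p, fun n hn kx m => ?_⟩
  obtain ⟨k, x⟩ := kx
  obtain ⟨c, t, s, hE, ht, hA, hC⟩ := h n hn k m
  have h1 := execLE_copyProg (M := 3) (by omega) (inputStore n (bits n x ++ 𝒰.encode n k) m) n rfl
  have h2 := execLE_phaseProg (inputStore n (bits n x ++ 𝒰.encode n k) m) (bits n x)
    (𝒰.encode n k)
  have hlen : (bits n x).length = n := List.length_ofFn
  have e1 : Function.update (inputStore n (bits n x ++ 𝒰.encode n k) m) 1
      (bits n x ++ 𝒰.encode n k) = inputStore n (bits n x ++ 𝒰.encode n k) m :=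
    Function.update_eq_self 1 _
  -- Once the phase digits are consumed, the store is precisely the input that the original
  -- generator expects.
  have e2 : Function.update (inputStore n (bits n x ++ 𝒰.encode n k) m) 1 (𝒰.encode n k) =
      inputStore n (𝒰.encode n k) m := by
    funext r
    match r with
    | 0 => rfl
    | 1 => rfl
    | 2 => rfl
    | r + 3 => rfl
  rw [hlen, e1, e2, mix_inputStore (by omega)] at h2
  rw [mix_inputStore (by omega)] at h1
  obtain ⟨t', ht', hE'⟩ := h1.seq_nil h2
  refine ⟨phaseCircuit (bits n x) ++ c, t' + t, s, .seq hE' hE, ?_, fun g hg => ?_,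
    computes_phase hC x⟩
  · simp only [Polynomial.eval_add, Polynomial.eval_mul, Polynomial.eval_pow, Polynomial.eval_C,
      Polynomial.eval_X, Polynomial.eval_one]
    nlinarith [Nat.zero_le (n * m), Nat.zero_le m, Nat.zero_le n]
  · rcases List.mem_append.mp hg with hg | hg
    exacts [allowed_phaseCircuit _ _ g hg, hA g hg]

end PRU

end

theorem corollary1p4 (𝒰 : PRU.UnitaryFamily) (S : Set PRU.QueryOp) (u : PRU.Uniformity)
    (h : 𝒰.IsPRU (PRU.Query.uncontrolled '' S) u) :
    𝒰.withPhase.IsPRU (PRU.Query.controlled '' S) u :=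
  ⟨h.1.withPhase, h.2.withPhase⟩
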